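/- All graphs are simple, and a connected graph is regarded as the metric space formed by its vertex set with the path metric. A metric space $X$ has $\mathrm{asdim}(X)\le n$ if every uniformly bounded open cover of $X$ refines some uniformly bounded open cover of $X$ in which every point lies in at most $n+1$ members; $\mathrm{asdim}(X)\in\mathbb N\cup\{\infty\}$ is the least such $n$. A group acts *quasi-transitively* on a graph if it acts by automorphisms with finitely many orbits of vertices; a graph is *quasi-transitive* if its automorphism group acts so. **Tree amalgamations.** Let $G_1,G_2$ be graphs, $I_1,I_2$ disjoint index sets, $(S^i_k)_{k\in I_i}$ families of subsets of $V(G_i)$ ($i=1,2$), all of the same cardinality, $\phi_{k\ell}\colon S^1_k\to S^2_\ell$ bijections ($k\in I_1$, $\ell\in I_2$), and $\phi_{\ell k}=\phi_{k\ell}^{-1}$. Let $T$ be a tree with bipartition $\{V_1,V_2\}$ whose directed edges are labelled by $f$ so that, for every $v\in V_i$, the edges starting at $v$ are labelled bijectively by $I_i$. Take a copy $G_v$ of $G_i$ for each $v\in V_i$ and, for every edge $\vec e=\vec{uv}$ of $T$ with $f(\vec e)=k$ and label $\ell$ of the reversed edge, join each $x$ in the copy of $S_k$ in $G_u$ to $\phi_{k\ell}(x)$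 in the copy of $S_\ell$ in $G_v$. Contracting all these new edges gives the *tree amalgamation* $G_1*_TG_2$; let $\pi$ be the contraction map on vertices. It is *trivial* if for some $v\in V(T)$ the restriction of $\pi$ to $V(G_v)$ is a bijection onto $V(G_1*_TG_2)$; it has *finite adhesion* if all sets $S^i_k$ are finite, and *finite identification* if there is a common bound, over all vertices $x$ of $G_1*_TG_2$, on the number of $v\in V(T)$ such that $x\in\pi(V(G_v))$. Let $\Gamma_i$ be a group acting on $G_i$ ($i=1,2$), and write $\{i,j\}=\{1,2\}$. The amalgamation *respects* $\Gamma_i$ if for every $\gamma\in\Gamma_i$ there is a permutation $\sigma$ of $I_i$ such that for every $k\in I_i$ there are $\ell\in I_j$ and $\tau\in\Gamma_j$ with $\tau(S_\ell)=S_\ell$ and $\phi_{k\ell}=\tau\circ\phi_{\sigma(k)\ell}\circ\gamma|_{S_k}$. The bonding maps between $J_i\subseteq I_i$ and $J_j\subseteq I_j$ are *consistent* if for all $k\in J_i$ and $\ell,\ell'\in J_j$ there is $\gamma\in\Gamma_j$ with $\phi_{k\ell}=\gamma\circ\phi_{k\ell'}$. The amalgamation *respects the actions* if it respects $\Gamma_1$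 and $\Gamma_2$ and either (Type 1) the bonding maps between $I_1$ and $I_2$ are consistent, or (Type 2) $G_1=G_2$, $\Gamma_1=\Gamma_2$ and $I_1=I_2=:I$ up to identification, and there is $J\subseteq I$ such that for every edge of $T$ exactly one of its two labels lies in $J$ and the bonding maps between $J$ and $I\setminus J$ are consistent (both for $J\subseteq I_1$, $I\setminus J\subseteq I_2$ and for $J\subseteq I_2$, $I\setminus J\subseteq I_1$). **Factorisations.** For locally finite quasi-transitive connected graphs, *factorisations* are defined recursively: $(G_1)$ is a factorisation of every graph isomorphic to $G_1$; if $(G_1,\dots,G_m)$ is a factorisation of $H_1$ and $(G_{m+1},\dots,G_n)$ is a factorisation of $H_2$, and $G$ is isomorphic to a non-trivial tree amalgamation of $H_1$ and $H_2$ of finite adhesion and finite identification that respects some quasi-transitive actions of groups on $H_1$ and $H_2$, then $(G_1,\dots,G_n)$, in any order, is a factorisation of $G$. Here $H_1$, $H_2$ and $G$ are locally finite, quasi-transitive and connected. **Theorem.** Let $(G_1,\dots,G_n)$ be a factorisation of a locally finite quasi-transitive connected graph $G$. Then $$\mathrm{asdim}(G)\le\max\{1,\ \mathrm{asdim}(G_i)\mid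 1\le i\le n\}.$$ -/

import Mathlib

universe u

noncomputable section

namespace TreeAmalg

/-! ### Asymptotic dimension of metric spaces -/

section Asdim

variable {X : Type u}

/-- `sup {diam V | V ∈ 𝒱}` is finite. -/
def UniformlyBounded [MetricSpace X] (𝒱 : Set (Set X)) : Prop :=
  ∃ D : ℝ, ∀ V ∈ 𝒱, ∀ x ∈ V, ∀ y ∈ V, dist x y ≤ D

/-- A uniformly bounded open cover of `X`. -/
structure IsBoundedOpenCover [MetricSpace X] (𝒱 : Set (Set X)) : Prop where
  isOpen : ∀ V ∈ 𝒱, IsOpen V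
  cover : ⋃₀ 𝒱 = Set.univ
  bounded : UniformlyBounded 𝒱

/-- Every point lies in at most `m` members of the family. -/
def MultiplicityLE (𝒱 : Set (Set X)) (m : ℕ) : Prop :=
  ∀ x : X, {V ∈ 𝒱 | x ∈ V}.encard ≤ m

/-- `𝒰` refines `𝒱`. -/
def Refines (𝒰 𝒱 : Set (Set X)) : Prop :=
  ∀ U ∈ 𝒰, ∃ V ∈ 𝒱, U ⊆ V

/-- `X` has asymptotic dimension at most `n`. -/
def AsdimLE (X : Type u) [MetricSpace X] (n : ℕ) : Prop :=
  ∀ 𝒱 : Set (Set X), IsBoundedOpenCover 𝒱 →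
    ∃ 𝒰 : Set (Set X), IsBoundedOpenCover 𝒰 ∧ MultiplicityLE 𝒰 (n + 1) ∧ Refines 𝒱 𝒰

/-- The asymptotic dimension, with value `⊤` if no finite bound exists. -/
def asdim (X : Type u) [MetricSpace X] : ℕ∞ :=
  ⨅ (n : ℕ) (_ : AsdimLE X n), (n : ℕ∞)

end Asdim

/-! ### Quasi-transitive graphs -/

section Graphs

variable {V : Type u}

/-- The vertex set of a connected graph with the path metric. -/
abbrev graphMetric (G : SimpleGraph V) (hG : G.Connected) : MetricSpace V where
  dist x y := (G.dist x y : ℝ)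
  dist_self x := by simp
  dist_comm x y := by rw [SimpleGraph.dist_comm]
  dist_triangle x y z := by exact_mod_cast hG.dist_triangle
  eq_of_dist_eq_zero := by
    intro x y h
    exact hG.dist_eq_zero_iff.mp (by exact_mod_cast h)

/-- A group of automorphisms of `G` with only finitely many orbits of vertices. -/
def ActsQuasiTransitively {G : SimpleGraph V} (Γ : Subgroup (G ≃g G)) : Prop :=
  ∃ F : Set V, F.Finite ∧ ∀ x : V, ∃ y ∈ F, ∃ γ ∈ Γ, γ y = x

end Graphs

/-- Locally finite quasi-transitive connected graphs. -/
structure QTGraph where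
  V : Type u
  graph : SimpleGraph V
  connected : graph.Connected
  locallyFinite : ∀ x : V, (graph.neighborSet x).Finite
  quasiTransitive : ActsQuasiTransitively (⊤ : Subgroup (graph ≃g graph))

/-- The asymptotic dimension of the vertex set with the path metric. -/
def QTGraph.asdim (G : QTGraph.{u}) : ℕ∞ :=
  @TreeAmalg.asdim G.V (graphMetric G.graph G.connected)

/-! ### Tree amalgamations -/

/-- The data of a tree amalgamation of `G₁` and `G₂`: families of subsets `S₁ k` of `V(G₁)` and
`S₂ ℓ` of `V(G₂)`, bonding maps `φ k ℓ`, a connecting tree with bipartition `T₁`, `T₂`, and a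
labelling of its directed edges. The labels of the edges that start at a node in `Tᵢ` are given as
a bijection from its neighbours to `Iᵢ`; in particular, such a node has degree `|Iᵢ|`. The bonding
maps force all sets `S₁ k`, `S₂ ℓ` to have the same cardinality. -/
structure TreeAmalgam {V₁ V₂ : Type u} (G₁ : SimpleGraph V₁) (G₂ : SimpleGraph V₂) where
  I₁ : Type u
  I₂ : Type u
  S₁ : I₁ → Set V₁
  S₂ : I₂ → Set V₂
  φ : ∀ (k : I₁) (ℓ : I₂), S₁ k ≃ S₂ ℓ
  T₁ : Type u
  T₂ : Type u
  tree : SimpleGraph (T₁ ⊕ T₂)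
  isTree : tree.IsTree
  not_adj_left : ∀ u u' : T₁, ¬ tree.Adj (Sum.inl u) (Sum.inl u')
  not_adj_right : ∀ v v' : T₂, ¬ tree.Adj (Sum.inr v) (Sum.inr v')
  /-- `label₁ u ⟨v, _⟩` is the label of the directed edge from `u` to `v`. -/
  label₁ : ∀ u : T₁, {v : T₂ // tree.Adj (Sum.inl u) (Sum.inr v)} ≃ I₁
  /-- `label₂ v ⟨u, _⟩` is the label of the directed edge from `v` to `u`. -/
  label₂ : ∀ v : T₂, {u : T₁ // tree.Adj (Sum.inl u) (Sum.inr v)} ≃ I₂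

namespace TreeAmalgam

variable {V₁ V₂ : Type u} {G₁ : SimpleGraph V₁} {G₂ : SimpleGraph V₂}

/-- The vertices of the disjoint union of copies of `G₁`, one for each node in `T₁`, and of copies
of `G₂`, one for each node in `T₂`. -/
abbrev Vert (A : TreeAmalgam G₁ G₂) : Type u := (A.T₁ × V₁) ⊕ (A.T₂ × V₂)

/-- The node of the connecting tree whose copy contains the given vertex. -/
def node (A : TreeAmalgam G₁ G₂) : A.Vert → A.T₁ ⊕ A.T₂ := Sum.map Prod.fst Prod.fst

/-- Two vertices in the same copy that are adjacent there. -/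
inductive CopyRel (A : TreeAmalgam G₁ G₂) : A.Vert → A.Vert → Prop
  | left (u : A.T₁) (x y : V₁) (h : G₁.Adj x y) : CopyRel A (Sum.inl (u, x)) (Sum.inl (u, y))
  | right (v : A.T₂) (x y : V₂) (h : G₂.Adj x y) : CopyRel A (Sum.inr (v, x)) (Sum.inr (v, y))

/-- For every edge `uv` of the connecting tree with labels `k` (from `u`) and `ℓ` (from `v`), each
`x` in the copy of `S₁ k` at `u` is related to `φ k ℓ x` in the copy of `S₂ ℓ` at `v`. -/
inductive BondRel (A : TreeAmalgam G₁ G₂) : A.Vert → A.Vert → Prop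
  | mk (u : A.T₁) (v : A.T₂) (h : A.tree.Adj (Sum.inl u) (Sum.inr v))
      (x : A.S₁ (A.label₁ u ⟨v, h⟩)) :
      BondRel A (Sum.inl (u, (x : V₁)))
        (Sum.inr (v, (A.φ (A.label₁ u ⟨v, h⟩) (A.label₂ v ⟨u, h⟩) x : V₂)))

/-- The disjoint union of all copies. -/
def copies (A : TreeAmalgam G₁ G₂) : SimpleGraph A.Vert := SimpleGraph.fromRel A.CopyRel

/-- The new edges between the copies. -/
def bonds (A : TreeAmalgam G₁ G₂) : SimpleGraph A.Vert := SimpleGraph.fromRel A.BondRel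

/-- The graph `G₁ + G₂`. -/
def sumGraph (A : TreeAmalgam G₁ G₂) : SimpleGraph A.Vert := A.copies ⊔ A.bonds

/-- The vertex set of the tree amalgamation, after contracting all new edges. -/
abbrev AmVert (A : TreeAmalgam G₁ G₂) : Type u := A.bonds.ConnectedComponent

/-- The contraction map. -/
def π (A : TreeAmalgam G₁ G₂) : A.Vert → A.AmVert := A.bonds.connectedComponentMk

/-- The tree amalgamation: `G₁ + G₂` with all new edges contracted (`SimpleGraph.map` discards the
resulting loops). -/
def graph (A : TreeAmalgam G₁ G₂) : SimpleGraph A.AmVert := A.sumGraph.map A.π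

/-- All adhesion sets are finite. -/
def FiniteAdhesion (A : TreeAmalgam G₁ G₂) : Prop :=
  (∀ k, (A.S₁ k).Finite) ∧ (∀ ℓ, (A.S₂ ℓ).Finite)

/-- For some node, the contraction map restricts to a bijection on the vertices of its copy. -/
def Trivial (A : TreeAmalgam G₁ G₂) : Prop :=
  (∃ u : A.T₁, Function.Bijective fun x : V₁ => A.π (Sum.inl (u, x))) ∨
  (∃ v : A.T₂, Function.Bijective fun x : V₂ => A.π (Sum.inr (v, x)))

/-- The nodes whose copy contains a vertex that is mapped to `x`. -/
def nodesOf (A : TreeAmalgam G₁ G₂) (x : A.AmVert) : Set (A.T₁ ⊕ A.T₂) :=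
  A.node '' (A.π ⁻¹' {x})

/-- The identification sizes of all vertices are bounded. -/
def FiniteIdentification (A : TreeAmalgam G₁ G₂) : Prop :=
  ∃ N : ℕ, ∀ x : A.AmVert, (A.nodesOf x).encard ≤ N

end TreeAmalgam

/-! ### Compatibility with group actions

A group acting on a graph enters only through its image in the automorphism group, so actions are
given as subgroups of the automorphism group. -/

section Actions

variable {V W I J : Type u} {G : SimpleGraph V} {H : SimpleGraph W}
  {S : I → Set V} {R : J → Set W}

/-- The bonding maps `φ k ℓ : S k → R ℓ` respect the automorphism `γ` of `G`, where `Δ` is the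
group acting on the other graph: for some permutation `σ` of the index set and every `k`, there are
`ℓ` and `τ ∈ Δ` stabilising `R ℓ` setwise with `φ k ℓ = τ ∘ φ (σ k) ℓ ∘ γ` on `S k`. -/
def RespectsElement (φ : ∀ k ℓ, S k ≃ R ℓ) (Δ : Subgroup (H ≃g H)) (γ : G ≃g G) : Prop :=
  ∃ σ : Equiv.Perm I, ∀ k : I, ∃ ℓ : J, ∃ τ ∈ Δ, τ '' R ℓ = R ℓ ∧
    ∀ x : S k, ∃ hx : γ x ∈ S (σ k), (φ k ℓ x : W) = τ (φ (σ k) ℓ ⟨γ x, hx⟩ : W)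

/-- The bonding maps respect every element of `Γ`. -/
def RespectsGroup (φ : ∀ k ℓ, S k ≃ R ℓ) (Γ : Subgroup (G ≃g G)) (Δ : Subgroup (H ≃g H)) : Prop :=
  ∀ γ ∈ Γ, RespectsElement φ Δ γ

/-- The bonding maps between `K ⊆ I` and `L ⊆ J` are consistent. -/
def Consistent (φ : ∀ k ℓ, S k ≃ R ℓ) (Δ : Subgroup (H ≃g H)) (K : Set I) (L : Set J) : Prop :=
  ∀ k ∈ K, ∀ ℓ ∈ L, ∀ ℓ' ∈ L, ∃ δ ∈ Δ, ∀ x : S k, (φ k ℓ x : W) = δ (φ k ℓ' x : W)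

end Actions

namespace TreeAmalgam

variable {V₁ V₂ : Type u} {G₁ : SimpleGraph V₁} {G₂ : SimpleGraph V₂}

/-- The bonding maps from the second side to the first one. -/
def φinv (A : TreeAmalgam G₁ G₂) (ℓ : A.I₂) (k : A.I₁) : A.S₂ ℓ ≃ A.S₁ k := (A.φ k ℓ).symm

/-- Both groups are respected. -/
def RespectsGroups (A : TreeAmalgam G₁ G₂) (Γ₁ : Subgroup (G₁ ≃g G₁)) (Γ₂ : Subgroup (G₂ ≃g G₂)) :
    Prop :=
  RespectsGroup A.φ Γ₁ Γ₂ ∧ RespectsGroup A.φinv Γ₂ Γ₁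

/-- Type 1 respecting the actions. -/
def IsType1 (A : TreeAmalgam G₁ G₂) (Γ₁ : Subgroup (G₁ ≃g G₁)) (Γ₂ : Subgroup (G₂ ≃g G₂)) : Prop :=
  A.RespectsGroups Γ₁ Γ₂ ∧ Consistent A.φ Γ₂ Set.univ Set.univ

/-- Type 2 respecting the actions. The identifications `G₁ = G₂`, `Γ₁ = Γ₂` and `I₁ = I₂` are
given by an isomorphism `e` that carries `Γ₁` to `Γ₂`, and by a bijection `b`. -/
def IsType2 (A : TreeAmalgam G₁ G₂) (Γ₁ : Subgroup (G₁ ≃g G₁)) (Γ₂ : Subgroup (G₂ ≃g G₂)) : Prop :=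
  ∃ (e : G₁ ≃g G₂) (b : A.I₁ ≃ A.I₂) (J : Set A.I₁),
    (∀ γ : G₁ ≃g G₁, γ ∈ Γ₁ ↔ (e.symm.trans (γ.trans e) : G₂ ≃g G₂) ∈ Γ₂) ∧
    (∀ (u : A.T₁) (v : A.T₂) (h : A.tree.Adj (Sum.inl u) (Sum.inr v)),
      A.label₁ u ⟨v, h⟩ ∈ J ↔ A.label₂ v ⟨u, h⟩ ∉ b '' J) ∧
    A.RespectsGroups Γ₁ Γ₂ ∧
    Consistent A.φ Γ₂ J (b '' J)ᶜ ∧ Consistent A.φinv Γ₁ (b '' J) Jᶜ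

/-- The tree amalgamation respects the actions of `Γ₁` and `Γ₂`. -/
def RespectsActions (A : TreeAmalgam G₁ G₂) (Γ₁ : Subgroup (G₁ ≃g G₁))
    (Γ₂ : Subgroup (G₂ ≃g G₂)) : Prop :=
  A.IsType1 Γ₁ Γ₂ ∨ A.IsType2 Γ₁ Γ₂

end TreeAmalgam

/-! ### Factorisations -/

/-- `G` is, up to isomorphism, a non-trivial tree amalgamation of `G₁` and `G₂` of finite adhesion
and finite identification that respects some quasi-transitive actions on `G₁` and `G₂`. -/
def IsAmalgamOf (G G₁ G₂ : QTGraph.{u}) : Prop :=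
  ∃ A : TreeAmalgam G₁.graph G₂.graph,
    ¬ A.Trivial ∧ A.FiniteAdhesion ∧ A.FiniteIdentification ∧
    (∃ (Γ₁ : Subgroup (G₁.graph ≃g G₁.graph)) (Γ₂ : Subgroup (G₂.graph ≃g G₂.graph)),
      ActsQuasiTransitively Γ₁ ∧ ActsQuasiTransitively Γ₂ ∧ A.RespectsActions Γ₁ Γ₂) ∧
    Nonempty (G.graph ≃g A.graph)

/-- The list `L` is a factorisation of `G`: `G` is obtained by iterated tree amalgamations of all
members of `L`, in any order and with any bracketing. -/
inductive IsFactorisation : List QTGraph.{u} → QTGraph.{u} → Prop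
  | single (G₁ G : QTGraph.{u}) (h : Nonempty (G.graph ≃g G₁.graph)) : IsFactorisation [G₁] G
  | amalgam (L₁ L₂ : List QTGraph.{u}) (G₁ G₂ G : QTGraph.{u})
      (h₁ : IsFactorisation L₁ G₁) (h₂ : IsFactorisation L₂ G₂) (h : IsAmalgamOf G G₁ G₂) :
      IsFactorisation (L₁ ++ L₂) G
  | perm (L L' : List QTGraph.{u}) (G : QTGraph.{u}) (hL : L.Perm L') (h : IsFactorisation L G) :
      IsFactorisation L' G

end TreeAmalg

end

/-!
The asymptotic dimension of a graph is at most `n` if and only if, at each scale `R`, its vertices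
can be coloured with `n + 1` colours so that monochromatic chains of steps of length at most `R`
stay bounded. The images of the copies form a tree decomposition of the amalgamation. By finite
identification each vertex lies in only finitely many of the finite sets `S_k`, so up to the group
actions there are finitely many such sets, and the adhesion sets have bounded diameter. A walk that
leaves a copy returns through the same adhesion set, so the amalgamation is mapped to each copy by
a Lipschitz retraction, and colourings of `G₁` and `G₂` give colourings of all bags with a common
bound.

To glue these colourings, root the tree and merge a bag into the block of its parent if its adhesion
set is close to the gate of that block, which is the adhesion set of the topmost bag of the block.
Then the gate of a block is far from the gate of the block above it, and away from the gate the
chains within a block stay inside one bag. Vertices close to a gate are moved through it into the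
block above, and what lies around the gate on its lower side gets a colour different from theirs.
This stops long chains from crossing the gate, and it needs two colours, hence the maximum with 1.
-/

namespace TreeAmalg

open Relation Metric

section Metric

variable {X : Type u} [MetricSpace X] {n : ℕ}

theorem AsdimLE.mono {m : ℕ} (hmn : m ≤ n) (h : AsdimLE X m) : AsdimLE X n := by
  intro 𝒱 h𝒱
  obtain ⟨𝒰, h𝒰, hmult, href⟩ := h 𝒱 h𝒱
  exact ⟨𝒰, h𝒰, fun x => (hmult x).trans (by gcongr), href⟩

theorem asdim_le_coe_iff : asdim X ≤ n ↔ AsdimLE X n := by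
  refine ⟨fun h => ?_, fun h => iInf₂_le n h⟩
  by_contra hn
  have hlt : ((n + 1 : ℕ) : ℕ∞) ≤ asdim X := le_iInf₂ fun m hm => by
    have : ¬ m ≤ n := fun hmn => hn (hm.mono hmn)
    exact_mod_cast not_le.mp this
  have : n + 1 ≤ n := by exact_mod_cast hlt.trans h
  omega

theorem isBoundedOpenCover_range_ball {r : ℝ} (hr : 0 < r) :
    IsBoundedOpenCover (Set.range fun x : X => ball x r) where
  isOpen := by
    rintro _ ⟨x, rfl⟩
    exact isOpen_ball
  cover := Set.eq_univ_of_forall fun x => ⟨_, ⟨x, rfl⟩, mem_ball_self hr⟩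
  bounded := by
    refine ⟨r + r, ?_⟩
    rintro _ ⟨z, rfl⟩ x hx y hy
    exact (dist_triangle_right x y z).trans (add_le_add hx.le hy.le)

/-- If each of the `n + 1` gaps between consecutive radii `g, 2g, …, (n + 2)g` were realised by some
member, then these members and one that contains the largest ball would be `n + 2` members
through `x`. -/
theorem MultiplicityLE.exists_gap {𝒰 : Set (Set X)} (hmult : MultiplicityLE 𝒰 (n + 1)) {g : ℝ}
    (hg : 0 < g) {x : X} (hx : ∃ U ∈ 𝒰, ball x ((n + 2) * g) ⊆ U) :
    ∃ j : Fin (n + 1), ∀ U ∈ 𝒰, ball x ((j + 1) * g) ⊆ U → ball x ((j + 2) * g) ⊆ U := by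
  by_contra! hgap
  have hlevel : ∀ j : Fin (n + 2), ∃ U ∈ 𝒰, ball x ((j + 1) * g) ⊆ U ∧
      ∀ i : Fin (n + 2), j < i → ¬ ball x ((i + 1) * g) ⊆ U := by
    intro j
    induction j using Fin.lastCases with
    | last =>
      obtain ⟨U, hU, hxU⟩ := hx
      refine ⟨U, hU, by simpa [add_assoc, one_add_one_eq_two] using hxU, fun i hi => ?_⟩
      exact absurd hi (Fin.le_last i).not_gt
    | cast j =>
      obtain ⟨U, hU, hjU, hjU'⟩ := hgap j
      refine ⟨U, hU, hjU, fun i hi hiU => hjU' ((ball_subset_ball ?_).trans hiU)⟩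
      have : (j : ℝ) + 1 ≤ i := by exact_mod_cast hi
      exact mul_le_mul_of_nonneg_right (by linarith) hg.le
  choose U hU𝒰 hjU hiU using hlevel
  have hinj : Function.Injective U := by
    intro i j hij
    rcases lt_trichotomy i j with h | h | h
    · exact absurd (hij ▸ hjU j) (hiU i j h)
    · exact h
    · exact absurd (hij ▸ hjU i) (hiU j i h)
  have hsub : Set.range U ⊆ {V ∈ 𝒰 | x ∈ V} := by
    rintro _ ⟨j, rfl⟩
    exact ⟨hU𝒰 j, hjU j (mem_ball_self (by positivity))⟩
  have hcard := (Set.encard_le_encard hsub).trans (hmult x)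
  rw [← Set.image_univ, hinj.encard_image, Set.encard_univ, ENat.card_eq_coe_fintype_card,
    Fintype.card_fin] at hcard
  have : n + 2 ≤ n + 1 := by exact_mod_cast hcard
  omega

theorem AsdimLE.exists_colouring (h : AsdimLE X n) (R : ℝ) :
    ∃ (B : ℝ) (c : X → Fin (n + 1)), ∀ x y,
      ReflTransGen (fun a b => c a = c b ∧ dist a b ≤ R) x y → dist x y ≤ B := by
  set g := |R| + 1
  have hg : 0 < g := by positivity
  obtain ⟨𝒰, hcover, hmult, href⟩ := h _ (isBoundedOpenCover_range_ball
    (show 0 < (n + 2) * g by positivity))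
  have hball : ∀ x, ∃ U ∈ 𝒰, ball x ((n + 2) * g) ⊆ U := fun x => href _ ⟨x, rfl⟩
  choose c hc using fun x => hmult.exists_gap hg (hball x)
  obtain ⟨B, hB⟩ := hcover.bounded
  refine ⟨B, c, fun x y hxy => ?_⟩
  obtain ⟨U, hU, hxU⟩ := hball x
  have hchain : c x = c y ∧ ball y ((c y + 2) * g) ⊆ U := by
    induction hxy with
    | refl =>
      have : (c x : ℝ) ≤ n := by exact_mod_cast (c x).is_le
      exact ⟨rfl, (ball_subset_ball (by gcongr)).trans hxU⟩
    | @tail a b _ hab ih =>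
      refine ⟨ih.1.trans hab.1, hc b U hU (Set.Subset.trans (ball_subset_ball' ?_) ih.2)⟩
      have : dist b a ≤ g := by
        rw [dist_comm]
        exact hab.2.trans ((le_abs_self R).trans (le_add_of_nonneg_right zero_le_one))
      rw [hab.1]
      linarith
  exact hB U hU x (hxU (mem_ball_self (by positivity))) y
    (hchain.2 (mem_ball_self (by positivity)))

theorem multiplicityLE_range_of_colouring {c : X → Fin n} {N : X → Set X} {d : ℝ}
    (hN : ∀ x, ∀ z ∈ N x, ∃ y, N x = N y ∧ dist y z ≤ d)
    (hc : ∀ x y, c x = c y → dist x y ≤ 2 * d → N x = N y) :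
    MultiplicityLE (Set.range N) n := by
  intro x
  have : Nonempty X := ⟨x⟩
  have hcentre : ∀ U ∈ {V ∈ Set.range N | x ∈ V}, ∃ y, U = N y ∧ dist y x ≤ d := by
    rintro _ ⟨⟨z, rfl⟩, hx⟩
    exact hN z x hx
  choose! y hyN hyx using hcentre
  have hinj : Set.InjOn (c ∘ y) {V ∈ Set.range N | x ∈ V} := by
    intro U hU U' hU' hcol
    rw [hyN U hU, hyN U' hU']
    exact hc _ _ hcol (by linarith [dist_triangle_right (y U) (y U') x, hyx U hU, hyx U' hU'])
  simpa using Set.encard_le_encard_of_injOn (Set.mapsTo_univ _ _) hinj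

theorem AsdimLE.of_colouring [Nonempty X]
    (h : ∀ R : ℝ, ∃ (B : ℝ) (c : X → Fin (n + 1)), ∀ x y,
      ReflTransGen (fun a b => c a = c b ∧ dist a b ≤ R) x y → dist x y ≤ B) :
    AsdimLE X n := by
  intro 𝒱 h𝒱
  obtain ⟨D, hD⟩ := h𝒱.bounded
  set d := |D| + 1
  have hd : 0 < d := by positivity
  have hDd : D < d := (le_abs_self D).trans_lt (lt_add_one _)
  obtain ⟨B, c, hB⟩ := h (2 * d)
  set r : X → X → Prop := fun a b => c a = c b ∧ dist a b ≤ 2 * d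
  have : Std.Symm r := ⟨fun a b hab => ⟨hab.1.symm, dist_comm a b ▸ hab.2⟩⟩
  set N : X → Set X := fun x => thickening d {y | ReflTransGen r x y}
  have hN : ∀ {x y}, ReflTransGen r x y → N x = N y := fun {x y} hxy =>
    congrArg (thickening d) (Set.ext fun z => ⟨(symm hxy).trans, hxy.trans⟩)
  refine ⟨Set.range N, ⟨?_, ?_, d + B + d, ?_⟩, multiplicityLE_range_of_colouring (c := c) (d := d)
    (fun x z hz => ?_) fun x y hcol hxy => hN (.single ⟨hcol, hxy⟩), fun V hV => ?_⟩
  · rintro _ ⟨x, rfl⟩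
    exact isOpen_thickening
  · exact Set.eq_univ_of_forall fun x => ⟨N x, ⟨x, rfl⟩, self_subset_thickening hd _ .refl⟩
  · rintro _ ⟨x, rfl⟩ y hy z hz
    obtain ⟨y', hxy, hy⟩ := mem_thickening_iff.mp hy
    obtain ⟨z', hxz, hz⟩ := mem_thickening_iff.mp hz
    linarith [hB y' z' ((symm hxy).trans hxz), dist_triangle4_right y z y' z']
  · obtain ⟨y, hxy, hzy⟩ := mem_thickening_iff.mp hz
    exact ⟨y, hN hxy, dist_comm z y ▸ hzy.le⟩
  · rcases V.eq_empty_or_nonempty with rfl | ⟨x, hx⟩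
    · exact ⟨_, ⟨Classical.arbitrary X, rfl⟩, Set.empty_subset _⟩
    · exact ⟨N x, ⟨x, rfl⟩, fun z hz => mem_thickening_iff.mpr
        ⟨x, .refl, (hD V hV z hz x hx).trans_lt hDd⟩⟩

end Metric

section Colouring

variable {V V' κ κ' : Type*} {G : SimpleGraph V} {G' : SimpleGraph V'} {n : ℕ}

/-- The steps of monochromatic `R`-chains for a colouring `c` of the vertices. -/
def MonoStep (G : SimpleGraph V) (c : V → κ) (R : ℕ) (x y : V) : Prop :=
  c x = c y ∧ G.dist x y ≤ R

/-- The components of the colour classes at scale `R`, that is, the classes of vertices joined by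
monochromatic `R`-chains, have diameter at most `B`. -/
def BoundedChains (G : SimpleGraph V) (c : V → κ) (R B : ℕ) : Prop :=
  ∀ x y, ReflTransGen (MonoStep G c R) x y → G.dist x y ≤ B

/-- The form of asymptotic dimension at most `n` the constructions work with: at each scale, some
colouring with `n + 1` colours has uniformly bounded components. -/
def ColouringDimLE (G : SimpleGraph V) (n : ℕ) : Prop :=
  ∀ R, ∃ (B : ℕ) (c : V → Fin (n + 1)), BoundedChains G c R B

theorem asdimLE_graphMetric_iff {V : Type u} {G : SimpleGraph V} (hG : G.Connected) :
    @AsdimLE V (graphMetric G hG) n ↔ ColouringDimLE G n := by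
  let _ := graphMetric G hG
  have := hG.nonempty
  constructor
  · intro h R
    obtain ⟨B, c, hB⟩ := h.exists_colouring R
    refine ⟨⌈B⌉₊, c, fun x y hxy => Nat.cast_le.mp ((hB x y ?_).trans (Nat.le_ceil B))⟩
    exact ReflTransGen.mono (fun a b hab => ⟨hab.1, Nat.cast_le.mpr hab.2⟩) _ _ hxy
  · refine fun h => AsdimLE.of_colouring fun R => ?_
    obtain ⟨B, c, hB⟩ := h ⌊R⌋₊
    refine ⟨B, c, fun x y hxy => Nat.cast_le.mpr (hB x y ?_)⟩
    exact ReflTransGen.mono (fun a b hab => ⟨hab.1, Nat.le_floor hab.2⟩) _ _ hxy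

theorem edist_map_le (f : G →g G') (x y : V) : G'.edist (f x) (f y) ≤ G.edist x y :=
  le_iInf fun q => (SimpleGraph.edist_le (q.map f)).trans_eq (by simp)

theorem dist_iso (e : G ≃g G') (x y : V) : G'.dist (e x) (e y) = G.dist x y := by
  refine congrArg ENat.toNat (le_antisymm (edist_map_le e.toHom x y) ?_)
  simpa using edist_map_le e.symm.toHom (e x) (e y)

theorem ColouringDimLE.of_iso (e : G ≃g G') (h : ColouringDimLE G' n) : ColouringDimLE G n := by
  intro R
  obtain ⟨B, c, hB⟩ := h R
  refine ⟨B, c ∘ e, fun x y hxy => dist_iso e x y ▸ hB _ _ (hxy.lift e fun a b hab => ?_)⟩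
  exact ⟨hab.1, (dist_iso e a b).trans_le hab.2⟩

theorem BoundedChains.of_retract (hG : G.Connected) {c : V → κ} {c' : V → κ'} {ρ : V → V}
    {R R' B E : ℕ} (hρ : ∀ x, G.dist x (ρ x) ≤ E)
    (hstep : ∀ x y, MonoStep G c R x y → MonoStep G c' R' (ρ x) (ρ y))
    (h : BoundedChains G c' R' B) : BoundedChains G c R (2 * E + B) := by
  intro x y hxy
  have hρxy := h _ _ (hxy.lift ρ hstep)
  have hy := hρ y
  rw [G.dist_comm] at hy
  have h₁ := hG.dist_triangle (u := x) (v := ρ x) (w := y)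
  have h₂ := hG.dist_triangle (u := ρ x) (v := ρ y) (w := y)
  linarith [hρ x]

/-- The vertices at distance at most `r` from the set `S`. -/
def nbhd (G : SimpleGraph V) (r : ℕ) (S : Set V) : Set V :=
  {x | ∃ s ∈ S, G.dist x s ≤ r}

theorem dist_le_of_mem_nbhd (hG : G.Connected) {S : Set V} {D r : ℕ}
    (hS : ∀ s ∈ S, ∀ s' ∈ S, G.dist s s' ≤ D) {x y : V} (hx : x ∈ nbhd G r S)
    (hy : y ∈ nbhd G r S) : G.dist x y ≤ 2 * r + D := by
  obtain ⟨s, hs, hxs⟩ := hx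
  obtain ⟨s', hs', hys'⟩ := hy
  rw [G.dist_comm] at hys'
  have h₁ := hG.dist_triangle (u := x) (v := s) (w := y)
  have h₂ := hG.dist_triangle (u := s) (v := s') (w := y)
  linarith [hS s hs s' hs']

theorem mem_nbhd_add (hG : G.Connected) {S : Set V} {L R : ℕ} {x y : V}
    (h : x ∈ nbhd G L S ∨ y ∈ nbhd G L S) (hxy : G.dist x y ≤ R) :
    x ∈ nbhd G (L + R) S ∧ y ∈ nbhd G (L + R) S := by
  have key : ∀ {x y}, x ∈ nbhd G L S → G.dist x y ≤ R →
      x ∈ nbhd G (L + R) S ∧ y ∈ nbhd G (L + R) S := by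
    rintro x y ⟨s, hs, hxs⟩ hxy
    rw [G.dist_comm] at hxy
    have := hG.dist_triangle (u := y) (v := x) (w := s)
    exact ⟨⟨s, hs, by linarith⟩, s, hs, by linarith⟩
  exact h.elim (key · hxy) fun h => (key h (G.dist_comm ▸ hxy)).symm

theorem BoundedChains.of_far (hG : G.Connected) {f : V → κ} {f' : V → κ'} {S : κ → Set V}
    {R L D B : ℕ} (hS : ∀ z, ∀ s ∈ S z, ∀ s' ∈ S z, G.dist s s' ≤ D)
    (hstep : ∀ x y, MonoStep G f R x y → x ∉ nbhd G L (S (f x)) → y ∉ nbhd G L (S (f y)) →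
      MonoStep G f' R x y)
    (h : BoundedChains G f' R B) : BoundedChains G f R (2 * (L + R + B) + D) := by
  intro x y hxy
  have hbreak : f x = f y ∧ (ReflTransGen (MonoStep G f' R) x y ∨
      ∃ a ∈ nbhd G (L + R) (S (f x)), ∃ b ∈ nbhd G (L + R) (S (f x)),
        ReflTransGen (MonoStep G f' R) x a ∧ ReflTransGen (MonoStep G f' R) b y) := by
    induction hxy with
    | refl => exact ⟨rfl, .inl .refl⟩
    | @tail y z _ hyz ih =>
      obtain ⟨hfxy, ih⟩ := ih
      refine ⟨hfxy.trans hyz.1, ?_⟩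
      by_cases hnear : y ∈ nbhd G L (S (f x)) ∨ z ∈ nbhd G L (S (f x))
      · obtain ⟨hy, hz⟩ := mem_nbhd_add hG hnear hyz.2
        rcases ih with ih | ⟨a, ha, -, -, hxa, -⟩
        · exact .inr ⟨y, hy, z, hz, ih, .refl⟩
        · exact .inr ⟨a, ha, z, hz, hxa, .refl⟩
      · rw [not_or, hfxy] at hnear
        have hyz' := hstep y z hyz hnear.1 (hyz.1 ▸ hnear.2)
        rcases ih with ih | ⟨a, ha, b, hb, hxa, hby⟩
        · exact .inl (ih.tail hyz')
        · exact .inr ⟨a, ha, b, hb, hxa, hby.tail hyz'⟩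
  rcases hbreak.2 with hxy | ⟨a, ha, b, hb, hxa, hby⟩
  · linarith [h x y hxy]
  · have h₁ := hG.dist_triangle (u := x) (v := a) (w := y)
    have h₂ := hG.dist_triangle (u := a) (v := b) (w := y)
    linarith [h x a hxa, h b y hby, dist_le_of_mem_nbhd hG (hS _) ha hb]

end Colouring

section Gated

variable {V Z κ N : Type*} {G : SimpleGraph V}

/-- `s` lies on a geodesic from `x` to `y`. -/
def IsBetween (G : SimpleGraph V) (x s y : V) : Prop :=
  G.dist x s + G.dist s y ≤ G.dist x y

theorem IsBetween.symm {x s y : V} (h : IsBetween G x s y) : IsBetween G y s x := by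
  unfold IsBetween at h ⊢
  rw [G.dist_comm (u := y) (v := s), G.dist_comm (u := s) (v := x), G.dist_comm (u := y) (v := x),
    add_comm]
  exact h

/-- A partition of the vertices into blocks, `b x` being the block of `x`, where each block `z` has
a gate `S z` of diameter at most `D`. Any two blocks are separated by one of their gates, the gate
of a block lies in a single block of smaller rank, and it is `K`-far from the gate of that block. -/
structure IsGated (G : SimpleGraph V) (b : V → Z) (S : Z → Set V) (rank : Z → ℕ) (D K : ℕ) :
    Prop where
  diam_le : ∀ z, ∀ s ∈ S z, ∀ s' ∈ S z, G.dist s s' ≤ D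
  separates : ∀ x y, b x ≠ b y → ∃ s ∈ S (b x) ∪ S (b y), IsBetween G x s y
  rank_lt : ∀ x, ∀ s ∈ S (b x), rank (b s) < rank (b x)
  block_eq : ∀ x, ∀ s ∈ S (b x), ∀ s' ∈ S (b x), b s = b s'
  far : ∀ x, ∀ s ∈ S (b x), ∀ s' ∈ S (b s), K ≤ G.dist s s'

theorem exists_recursive {α β : Type*} (μ : α → ℕ) (f : α → α) (g : α → β → β) (a₀ : α → β) :
    ∃ a : α → β, ∀ z, a z = if μ (f z) < μ z then g z (a (f z)) else a₀ z := by
  have hwf : WellFounded fun y z => μ y < μ z := (measure μ).wf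
  refine ⟨hwf.fix fun z a => if h : μ (f z) < μ z then g z (a (f z) h) else a₀ z, fun z => ?_⟩
  rw [hwf.fix_eq]
  split <;> rfl

open Classical in
/-- The map that moves the vertices at distance at most `R` from the gate of their block to a fixed
point `p z` of that gate, and thereby into a block of smaller rank. -/
noncomputable def retract (G : SimpleGraph V) (b : V → Z) (S : Z → Set V) (p : Z → V) (R : ℕ)
    (x : V) : V :=
  if x ∈ nbhd G R (S (b x)) then p (b x) else x

namespace IsGated

variable {b : V → Z} {S : Z → Set V} {rank : Z → ℕ} {D K R L : ℕ} {p : Z → V}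

theorem block_eq_of_notMem (h : IsGated G b S rank D K) {x y : V} (hxy : G.dist x y ≤ R)
    (hx : x ∉ nbhd G R (S (b x))) (hy : y ∉ nbhd G R (S (b y))) : b x = b y := by
  by_contra hne
  obtain ⟨s, hs | hs, hbetween⟩ := h.separates x y hne
  · exact hx ⟨s, hs, (Nat.le_of_add_right_le hbetween).trans hxy⟩
  · exact hy ⟨s, hs, G.dist_comm ▸ (Nat.le_of_add_left_le hbetween).trans hxy⟩

theorem gate_notMem_nbhd (h : IsGated G b S rank D K) (hK : R < K) {x s : V} (hs : s ∈ S (b x)) :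
    s ∉ nbhd G R (S (b s)) :=
  fun ⟨s', hs', hle⟩ => (hK.trans_le (h.far x s hs s' hs')).not_ge hle

theorem dist_retract_le (h : IsGated G b S rank D K) (hG : G.Connected)
    (hp : ∀ z, (S z).Nonempty → p z ∈ S z) (x : V) : G.dist x (retract G b S p R x) ≤ R + D := by
  unfold retract
  split_ifs with hx
  · obtain ⟨s, hs, hxs⟩ := hx
    have := hG.dist_triangle (u := x) (v := s) (w := p (b x))
    linarith [h.diam_le _ s hs _ (hp _ ⟨s, hs⟩)]
  · simp

theorem block_retract (h : IsGated G b S rank D K) (hp : ∀ z, (S z).Nonempty → p z ∈ S z) {x s : V}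
    (hs : s ∈ S (b x)) (hxs : G.dist x s ≤ R) : b (retract G b S p R x) = b s := by
  rw [retract, if_pos ⟨s, hs, hxs⟩]
  exact h.block_eq x _ (hp _ ⟨s, hs⟩) s hs

theorem block_retract_eq_of_isBetween (h : IsGated G b S rank D K) (hG : G.Connected)
    (hp : ∀ z, (S z).Nonempty → p z ∈ S z) (hK : 2 * R < K) {x y s : V} (hxy : G.dist x y ≤ R)
    (hs : s ∈ S (b x)) (hbetween : IsBetween G x s y) :
    b (retract G b S p R x) = b (retract G b S p R y) := by
  have hsy : G.dist s y ≤ R := (Nat.le_of_add_left_le hbetween).trans hxy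
  rw [h.block_retract hp hs ((Nat.le_of_add_right_le hbetween).trans hxy)]
  by_cases hy : y ∈ nbhd G R (S (b y))
  · obtain ⟨s', hs', hys'⟩ := hy
    have := hG.dist_triangle (u := s) (v := y) (w := s')
    rw [h.block_retract hp hs' hys']
    exact h.block_eq_of_notMem (by linarith) (h.gate_notMem_nbhd hK hs) (h.gate_notMem_nbhd hK hs')
  · rw [retract, if_neg hy]
    exact h.block_eq_of_notMem hsy (h.gate_notMem_nbhd (by omega) hs) hy

/-- Recolouring around the gates, by recursion on the rank, keeps the part of a block near its gate
apart from the part that is moved through the gate. -/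
theorem exists_colouring [Nontrivial κ] (h : IsGated G b S rank D K)
    (hp : ∀ z, (S z).Nonempty → p z ∈ S z) (L : ℕ) (c : V → κ) :
    ∃ c' : V → κ, (∀ x ∈ nbhd G L (S (b x)), c' x ≠ c' (p (b x))) ∧
      ∀ x ∉ nbhd G L (S (b x)), c' x = c x := by
  classical
  choose other hother using fun k : κ => exists_ne k
  obtain ⟨c', hc'⟩ := exists_recursive (fun x => rank (b x)) (fun x => p (b x))
    (fun x k => if x ∈ nbhd G L (S (b x)) then other k else c x) c
  refine ⟨c', fun x hx => ?_, fun x hx => by rw [hc', if_neg hx, ite_self]⟩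
  obtain ⟨s, hs, -⟩ := id hx
  rw [hc' x, if_pos (h.rank_lt x _ (hp _ ⟨s, hs⟩)), if_pos hx]
  exact hother _

theorem block_retract_eq (h : IsGated G b S rank D K) (hG : G.Connected)
    (hp : ∀ z, (S z).Nonempty → p z ∈ S z) (hK : 2 * R < K) (hL : 2 * R ≤ L) {c : V → κ}
    (hc : ∀ x ∈ nbhd G L (S (b x)), c x ≠ c (p (b x))) {x y : V}
    (hxy : MonoStep G (c ∘ retract G b S p R) R x y) :
    b (retract G b S p R x) = b (retract G b S p R y) := by
  obtain ⟨hcol, hdist⟩ := hxy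
  rcases ne_or_eq (b x) (b y) with hne | heq
  · obtain ⟨s, hs | hs, hbetween⟩ := h.separates x y hne
    · exact h.block_retract_eq_of_isBetween hG hp hK hdist hs hbetween
    · exact (h.block_retract_eq_of_isBetween hG hp hK (G.dist_comm ▸ hdist) hs hbetween.symm).symm
  · have hmixed : ∀ {x y}, b x = b y → G.dist x y ≤ R → x ∈ nbhd G R (S (b x)) →
        y ∉ nbhd G R (S (b y)) →
        (c ∘ retract G b S p R) y ≠ (c ∘ retract G b S p R) x := by
      intro x y heq hdist hx hy
      obtain ⟨s, hs, hys⟩ := (mem_nbhd_add hG (.inl hx) hdist).2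
      simp only [Function.comp_apply, retract, if_pos hx, if_neg hy, heq]
      exact hc y ⟨s, heq ▸ hs, by linarith⟩
    by_cases hx : x ∈ nbhd G R (S (b x)) <;> by_cases hy : y ∈ nbhd G R (S (b y))
    · simp only [retract, if_pos hx, if_pos hy, heq]
    · exact absurd hcol.symm (hmixed heq hdist hx hy)
    · exact absurd hcol (hmixed heq.symm (G.dist_comm ▸ hdist) hy hx)
    · simp only [retract, if_neg hx, if_neg hy, heq]

theorem exists_boundedChains [Nontrivial κ] (h : IsGated G b S rank D K) (hG : G.Connected)
    (hK : 2 * R < K) (hL : 2 * R ≤ L) {t : V → N} {c : V → κ} {B : ℕ}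
    (ht : ∀ x y, b x = b y → G.dist x y ≤ R + 2 * (R + D) → x ∉ nbhd G L (S (b x)) →
      y ∉ nbhd G L (S (b y)) → t x = t y)
    (hc : BoundedChains G (fun x => (t x, c x)) (R + 2 * (R + D)) B) :
    ∃ c' : V → κ, BoundedChains G c' R (2 * (R + D) + (2 * (L + (R + 2 * (R + D)) + B) + D)) := by
  have := hG.nonempty
  choose! p hp using fun (z : Z) (hz : (S z).Nonempty) => hz
  obtain ⟨c', hnear, hfar⟩ := h.exists_colouring hp L c
  refine ⟨c' ∘ retract G b S p R, BoundedChains.of_retract (c' := fun x => (b x, c' x)) hG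
    (h.dist_retract_le hG hp) (fun x y hxy => ?_)
    (BoundedChains.of_far (S := S ∘ Prod.fst) hG (fun z => h.diam_le z.1) ?_ hc)⟩
  · refine ⟨Prod.ext (h.block_retract_eq hG hp hK hL hnear hxy) hxy.1, ?_⟩
    have hx := h.dist_retract_le (R := R) hG hp x
    have hy := h.dist_retract_le (R := R) hG hp y
    rw [G.dist_comm] at hx
    have h₁ := hG.dist_triangle (u := retract G b S p R x) (v := x) (w := retract G b S p R y)
    have h₂ := hG.dist_triangle (u := x) (v := y) (w := retract G b S p R y)
    linarith [hxy.2]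
  · rintro x y ⟨hxy, hdist⟩ hx hy
    have hcol : c' x = c' y := congrArg Prod.snd hxy
    rw [hfar x hx, hfar y hy] at hcol
    exact ⟨Prod.ext (ht x y (congrArg Prod.fst hxy) hdist hx hy) hcol, hdist⟩

end IsGated

end Gated

/-- A rooted forest with node set `N`. The value of `parent` at a root, that is, at a node of depth
`0`, is junk. -/
structure RootedForest (N : Type*) where
  depth : N → ℕ
  parent : N → N
  depth_parent : ∀ w, depth w ≠ 0 → depth w = depth (parent w) + 1

namespace RootedForest

variable {N : Type*} {F : RootedForest N}

/-- `F.Anc w u` means that `w` is `u` or an ancestor of `u`. -/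
inductive Anc (F : RootedForest N) (w : N) : N → Prop
  | refl : F.Anc w w
  | of_parent {u : N} (hu : F.depth u ≠ 0) (h : F.Anc w (F.parent u)) : F.Anc w u

theorem induction {motive : N → Prop}
    (step : ∀ w, (F.depth w ≠ 0 → motive (F.parent w)) → motive w) (w : N) : motive w := by
  induction hk : F.depth w generalizing w with
  | zero => exact step w fun h => absurd hk h
  | succ k ih => exact step w fun h => ih _ (by have := F.depth_parent w h; omega)

theorem Anc.depth_le {w u : N} (h : F.Anc w u) : F.depth w ≤ F.depth u := by
  induction h with
  | refl => exact le_rfl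
  | of_parent hu _ ih => exact ih.trans (F.depth_parent _ hu ▸ Nat.le_succ _)

theorem Anc.antisymm {w u : N} (h : F.Anc w u) (h' : F.Anc u w) : w = u := by
  cases h with
  | refl => rfl
  | of_parent hu h =>
    have := F.depth_parent u hu
    have := h.depth_le
    have := h'.depth_le
    omega

theorem Anc.trans {w u v : N} (h : F.Anc w u) (h' : F.Anc u v) : F.Anc w v := by
  induction h' with
  | refl => exact h
  | of_parent hu _ ih => exact .of_parent hu ih

end RootedForest

section RootedDecomposition

variable {V N κ : Type*} {G : SimpleGraph V} {F : RootedForest N} {bag : N → Set V} {home : V → N}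
  {D K : ℕ}

/-- The vertices that the bag of `w` shares with the bag of its parent, if `home x` is the topmost
node whose bag contains `x`. -/
def adhesion (bag : N → Set V) (home : V → N) (w : N) : Set V :=
  {x ∈ bag w | home x ≠ w}

/-- A decomposition of `G` into bags indexed by the nodes of a rooted forest, where `home x` is the
topmost node whose bag contains `x`, and where the adhesion sets have diameter at most `D`. -/
structure IsRootedDecomposition (G : SimpleGraph V) (F : RootedForest N) (bag : N → Set V)
    (home : V → N) (D : ℕ) : Prop where
  mem_home : ∀ x, x ∈ bag (home x)
  depth_ne_zero : ∀ w, ∀ x ∈ adhesion bag home w, F.depth w ≠ 0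
  mem_parent : ∀ w, ∀ x ∈ adhesion bag home w, x ∈ bag (F.parent w)
  adj_mem : ∀ x y, G.Adj x y → ∃ w, x ∈ bag w ∧ y ∈ bag w
  diam_le : ∀ w, ∀ s ∈ adhesion bag home w, ∀ t ∈ adhesion bag home w, G.dist s t ≤ D

/-- `m w` is the lowest anchor among `w` and its ancestors, where a node is an anchor if it is a
root or its set `S w` has distance at least `K` from that of the next anchor above it. Roots need no
separate treatment because `S` is empty there in all uses. -/
structure IsAnchorMap (G : SimpleGraph V) (F : RootedForest N) (S : N → Set V) (K : ℕ) (m : N → N) :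
    Prop where
  of_near : ∀ w, ∀ s ∈ S w, ∀ s' ∈ S (m (F.parent w)), G.dist s s' < K → m w = m (F.parent w)
  of_far : ∀ w, (∀ s ∈ S w, ∀ s' ∈ S (m (F.parent w)), K ≤ G.dist s s') → m w = w

theorem IsAnchorMap.eq_or_near {S : N → Set V} {m : N → N} (hm : IsAnchorMap G F S K m) (w : N) :
    m w = w ∨ ∃ s ∈ S w, ∃ s' ∈ S (m w), G.dist s s' < K ∧ m w = m (F.parent w) := by
  by_cases h : ∃ s ∈ S w, ∃ s' ∈ S (m (F.parent w)), G.dist s s' < K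
  · obtain ⟨s, hs, s', hs', hlt⟩ := h
    have hmw := hm.of_near w s hs s' hs' hlt
    exact .inr ⟨s, hs, s', hmw ▸ hs', hlt, hmw⟩
  · push Not at h
    exact .inl (hm.of_far w h)

theorem exists_isAnchorMap (G : SimpleGraph V) {S : N → Set V}
    (hS : ∀ w, ∀ s ∈ S w, F.depth w ≠ 0) (K : ℕ) : ∃ m, IsAnchorMap G F S K m := by
  classical
  obtain ⟨m, hm⟩ := exists_recursive F.depth F.parent
    (fun w a => if ∃ s ∈ S w, ∃ s' ∈ S a, G.dist s s' < K then a else w) id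
  refine ⟨m, ⟨fun w s hs s' hs' hlt => ?_, fun w hfar => ?_⟩⟩
  · have hdepth : F.depth (F.parent w) < F.depth w :=
      F.depth_parent w (hS w s hs) ▸ Nat.lt_succ_self _
    rw [hm w, if_pos hdepth, if_pos ⟨s, hs, s', hs', hlt⟩]
  · have hnear : ¬ ∃ s ∈ S w, ∃ s' ∈ S (m (F.parent w)), G.dist s s' < K := by
      push Not
      exact hfar
    rw [hm w, if_neg hnear, id, ite_self]

namespace IsRootedDecomposition

theorem anc_home (h : IsRootedDecomposition G F bag home D) {x : V} (u : N) (hx : x ∈ bag u) :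
    F.Anc (home x) u := by
  induction u using F.induction with
  | step u ih =>
    by_cases hu : home x = u
    · exact hu ▸ .refl
    · have hdepth := h.depth_ne_zero u x ⟨hx, hu⟩
      exact .of_parent hdepth (ih hdepth (h.mem_parent u x ⟨hx, hu⟩))

theorem mem_adhesion (h : IsRootedDecomposition G F bag home D) {x : V} {w u : N} (hx : x ∈ bag u)
    (hu : F.Anc w u) (hw : ¬ F.Anc w (home x)) : x ∈ adhesion bag home w := by
  induction hu with
  | refl => exact ⟨hx, fun heq => hw (heq ▸ .refl)⟩
  | @of_parent u hdepth hu ih =>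
    exact ih (h.mem_parent u x ⟨hx, fun heq => hw (heq ▸ .of_parent hdepth hu)⟩)

theorem mem_adhesion_of_adj (h : IsRootedDecomposition G F bag home D) {w : N} {x y : V}
    (hxy : G.Adj x y) (hx : F.Anc w (home x)) (hy : ¬ F.Anc w (home y)) :
    y ∈ adhesion bag home w := by
  obtain ⟨u, hxu, hyu⟩ := h.adj_mem x y hxy
  exact h.mem_adhesion hyu (hx.trans (h.anc_home u hxu)) hy

theorem exists_isBetween (h : IsRootedDecomposition G F bag home D) (hG : G.Connected) {w : N}
    {x y : V} (hx : F.Anc w (home x)) (hy : ¬ F.Anc w (home y)) :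
    ∃ s ∈ adhesion bag home w, IsBetween G x s y := by
  obtain ⟨q, hq⟩ := hG.exists_walk_length_eq_dist x y
  unfold IsBetween
  rw [← hq]
  clear hq
  induction q with
  | nil => exact absurd hx hy
  | @cons x x' y hxx' q ih =>
    rw [SimpleGraph.Walk.length_cons]
    by_cases hx' : F.Anc w (home x')
    · obtain ⟨s, hs, hbetween⟩ := ih hx' hy
      have := hG.dist_triangle (u := x) (v := x') (w := s)
      rw [SimpleGraph.dist_eq_one_iff_adj.mpr hxx'] at this
      exact ⟨s, hs, by linarith⟩
    · refine ⟨x', h.mem_adhesion_of_adj hxx' hx hx', ?_⟩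
      rw [SimpleGraph.dist_eq_one_iff_adj.mpr hxx', add_comm]
      exact Nat.add_le_add_right (SimpleGraph.dist_le q) 1

variable {m : N → N}

theorem anchor_or_mem (h : IsRootedDecomposition G F bag home D)
    (hm : IsAnchorMap G F (adhesion bag home) K m) {x : V} (w : N) (hx : x ∈ bag w) :
    m (home x) = m w ∨ x ∈ adhesion bag home (m w) := by
  induction w using F.induction with
  | step w ih =>
    by_cases hw : home x = w
    · exact .inl (hw ▸ rfl)
    · rcases hm.eq_or_near w with heq | ⟨-, -, -, -, -, heq⟩
      · exact .inr (heq.symm ▸ ⟨hx, hw⟩)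
      · rw [heq]
        exact ih (h.depth_ne_zero w x ⟨hx, hw⟩) (h.mem_parent w x ⟨hx, hw⟩)

theorem anc_anchor (h : IsRootedDecomposition G F bag home D)
    (hm : IsAnchorMap G F (adhesion bag home) K m) (w : N) : F.Anc (m w) w ∧ m (m w) = m w := by
  induction w using F.induction with
  | step w ih =>
    rcases hm.eq_or_near w with heq | ⟨s, hs, -, -, -, heq⟩
    · rw [heq, heq]
      exact ⟨.refl, rfl⟩
    · have hdepth := h.depth_ne_zero w s hs
      rw [heq]
      exact ⟨.of_parent hdepth (ih hdepth).1, (ih hdepth).2⟩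

theorem anc_anchor_of_anc (hm : IsAnchorMap G F (adhesion bag home) K m) {z w : N} (hz : m z = z)
    (hzw : F.Anc z w) : F.Anc z (m w) := by
  induction hzw with
  | refl => exact hz.symm ▸ .refl
  | @of_parent w hdepth hzw ih =>
    rcases hm.eq_or_near w with heq | ⟨-, -, -, -, -, heq⟩
    · exact heq.symm ▸ .of_parent hdepth hzw
    · exact heq ▸ ih

theorem exists_isBetween_of_anchor_ne (h : IsRootedDecomposition G F bag home D) (hG : G.Connected)
    (hm : IsAnchorMap G F (adhesion bag home) K m) {x y : V} (hne : m (home x) ≠ m (home y)) :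
    ∃ s ∈ adhesion bag home (m (home x)) ∪ adhesion bag home (m (home y)), IsBetween G x s y := by
  obtain ⟨hx, hmx⟩ := h.anc_anchor hm (home x)
  obtain ⟨hy, hmy⟩ := h.anc_anchor hm (home y)
  by_cases hxy : F.Anc (m (home x)) (home y)
  · by_cases hyx : F.Anc (m (home y)) (home x)
    · exact absurd ((anc_anchor_of_anc hm hmx hxy).antisymm (anc_anchor_of_anc hm hmy hyx)) hne
    · obtain ⟨s, hs, hbetween⟩ := h.exists_isBetween hG hy hyx
      exact ⟨s, .inr hs, hbetween.symm⟩
  · obtain ⟨s, hs, hbetween⟩ := h.exists_isBetween hG hx hxy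
    exact ⟨s, .inl hs, hbetween⟩

theorem le_dist_of_anchor (h : IsRootedDecomposition G F bag home D)
    (hm : IsAnchorMap G F (adhesion bag home) K m) {z : N} (hz : m z = z) {s s' : V}
    (hs : s ∈ adhesion bag home z) (hs' : s' ∈ adhesion bag home (m (F.parent z))) :
    K ≤ G.dist s s' := by
  by_contra! hlt
  have hdepth := F.depth_parent z (h.depth_ne_zero z s hs)
  have hle := (h.anc_anchor hm (F.parent z)).1.depth_le
  rw [← hm.of_near z s hs s' hs' hlt, hz] at hle
  omega

theorem anchor_home_eq (h : IsRootedDecomposition G F bag home D)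
    (hm : IsAnchorMap G F (adhesion bag home) K m) (hK : 0 < K) {z : N} (hz : m z = z) {s : V}
    (hs : s ∈ adhesion bag home z) : m (home s) = m (F.parent z) :=
  (h.anchor_or_mem hm _ (h.mem_parent z s hs)).resolve_right fun hs' =>
    hK.not_ge (by simpa using h.le_dist_of_anchor hm hz hs hs')

theorem isGated (h : IsRootedDecomposition G F bag home D) (hG : G.Connected)
    (hm : IsAnchorMap G F (adhesion bag home) K m) (hK : 0 < K) :
    IsGated G (m ∘ home) (adhesion bag home) F.depth D K where
  diam_le := h.diam_le
  separates _ _ hne := h.exists_isBetween_of_anchor_ne hG hm hne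
  rank_lt x s hs := by
    have hdepth := F.depth_parent _ (h.depth_ne_zero _ s hs)
    have hle := (h.anc_anchor hm (F.parent (m (home x)))).1.depth_le
    rw [← h.anchor_home_eq hm hK (h.anc_anchor hm _).2 hs] at hle
    exact hdepth ▸ Nat.lt_succ_of_le hle
  block_eq x s hs s' hs' := (h.anchor_home_eq hm hK (h.anc_anchor hm _).2 hs).trans
    (h.anchor_home_eq hm hK (h.anc_anchor hm _).2 hs').symm
  far x s hs s' hs' := h.le_dist_of_anchor hm (h.anc_anchor hm _).2 hs
    (h.anchor_home_eq hm hK (h.anc_anchor hm _).2 hs ▸ hs')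

theorem home_eq_of_notMem_nbhd (h : IsRootedDecomposition G F bag home D) (hG : G.Connected)
    (hm : IsAnchorMap G F (adhesion bag home) K m) {x y : V} {R L : ℕ} (hR : G.dist x y ≤ R)
    (hL : R + D + K ≤ L)
    (hx : x ∉ nbhd G L (adhesion bag home (m (home x))))
    (hy : y ∉ nbhd G L (adhesion bag home (m (home y)))) : home x = home y := by
  have key : ∀ x y, G.dist x y ≤ R → x ∉ nbhd G L (adhesion bag home (m (home x))) →
      F.Anc (home x) (home y) := by
    intro x y hR hx
    by_contra hanc
    obtain ⟨s, hs, hbetween⟩ := h.exists_isBetween hG .refl hanc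
    have hxs : G.dist x s ≤ R := (Nat.le_of_add_right_le hbetween).trans hR
    rcases hm.eq_or_near (home x) with heq | ⟨s₁, hs₁, s₂, hs₂, hlt, -⟩
    · exact hx ⟨s, heq.symm ▸ hs, by omega⟩
    · have h₁ := h.diam_le _ s hs s₁ hs₁
      have h₂ := hG.dist_triangle (u := x) (v := s) (w := s₂)
      have h₃ := hG.dist_triangle (u := s) (v := s₁) (w := s₂)
      exact hx ⟨s₂, hs₂, by omega⟩
  exact (key x y hR hx).antisymm (key y x (G.dist_comm ▸ hR) hy)

theorem exists_boundedChains [Nontrivial κ] (h : IsRootedDecomposition G F bag home D)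
    (hG : G.Connected) (R B : ℕ) : ∃ B', ∀ c : V → κ,
      BoundedChains G (fun x => (home x, c x)) (R + 2 * (R + D)) B →
      ∃ c' : V → κ, BoundedChains G c' R B' := by
  obtain ⟨m, hm⟩ := exists_isAnchorMap G h.depth_ne_zero (2 * R + 1)
  refine ⟨_, fun c hc => (h.isGated hG hm (Nat.succ_pos _)).exists_boundedChains hG
    (L := R + 2 * (R + D) + D + (2 * R + 1)) (Nat.lt_succ_self _) (by omega)
    (fun x y _ hdist hx hy => ?_) hc⟩
  exact h.home_eq_of_notMem_nbhd hG hm hdist le_rfl hx hy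

end IsRootedDecomposition

end RootedDecomposition

section Tree

variable {N : Type*} {T : SimpleGraph N}

/-- The neighbour of `u` on the path from `u` to `v` in a tree; junk if `u = v`. -/
noncomputable def stepToward (hT : T.IsTree) (u v : N) : N :=
  (hT.existsUnique_path u v).choose.snd

theorem stepToward_eq_snd (hT : T.IsTree) {u v : N} {q : T.Walk u v} (hq : q.IsPath) :
    stepToward hT u v = q.snd :=
  congrArg _ ((hT.existsUnique_path u v).unique (hT.existsUnique_path u v).choose_spec.1 hq)

theorem stepToward_of_dist (hT : T.IsTree) {u u' v : N} (h : T.Adj u u')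
    (hdist : T.dist v u = T.dist v u' + 1) : stepToward hT u v = u' := by
  obtain ⟨q, -, hq⟩ := hT.connected.exists_path_of_dist u' v
  have hpath : (q.cons h).IsPath := SimpleGraph.Walk.isPath_of_length_eq_dist _ (by
    rw [SimpleGraph.Walk.length_cons, hq, T.dist_comm, ← hdist, T.dist_comm])
  rw [stepToward_eq_snd hT hpath, SimpleGraph.Walk.snd_cons]

theorem stepToward_of_adj (hT : T.IsTree) {u v : N} (h : T.Adj u v) : stepToward hT u v = v :=
  stepToward_of_dist hT h (by
    rw [SimpleGraph.dist_self, SimpleGraph.dist_eq_one_iff_adj.mpr h.symm])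

theorem adj_stepToward (hT : T.IsTree) {u v : N} (h : u ≠ v) : T.Adj u (stepToward hT u v) :=
  SimpleGraph.Walk.adj_snd (SimpleGraph.Walk.not_nil_of_ne h)

theorem dist_stepToward (hT : T.IsTree) {u v : N} (h : u ≠ v) :
    T.dist v u = T.dist v (stepToward hT u v) + 1 := by
  obtain ⟨q, hpath, hq⟩ := hT.connected.exists_path_of_dist u v
  rw [stepToward_eq_snd hT hpath, T.dist_comm, ← hq]
  cases q with
  | nil => exact absurd rfl h
  | cons hadj q =>
    rw [SimpleGraph.Walk.snd_cons]
    rcases hT.dist_eq_dist_add_one_of_adj v hadj with hd | hd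
    · rw [hq, T.dist_comm, hd]
    · have := SimpleGraph.dist_le q
      rw [T.dist_comm] at hq this
      rw [SimpleGraph.Walk.length_cons] at hq
      omega

theorem stepToward_congr (hT : T.IsTree) {u u' v : N} (h : T.Adj u u') (hu : u ≠ v)
    (hu' : u' ≠ v) : stepToward hT v u = stepToward hT v u' := by
  have key : ∀ u u', T.Adj u u' → u ≠ v → T.dist v u' = T.dist v u + 1 →
      stepToward hT v u = stepToward hT v u' := by
    intro u u' h hu hdist
    obtain ⟨q, hpath, hq⟩ := hT.connected.exists_path_of_dist v u
    have hpath' : (q.concat h).IsPath := SimpleGraph.Walk.isPath_of_length_eq_dist _ (by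
      rw [SimpleGraph.Walk.length_concat, hq, hdist])
    rw [stepToward_eq_snd hT hpath, stepToward_eq_snd hT hpath']
    cases q with
    | nil => exact absurd rfl hu
    | cons _ _ => rw [SimpleGraph.Walk.concat_cons, SimpleGraph.Walk.snd_cons,
        SimpleGraph.Walk.snd_cons]
  rcases hT.dist_eq_dist_add_one_of_adj v h with hdist | hdist
  · exact (key u' u h.symm hu' hdist).symm
  · exact key u u' h hu hdist

/-- The tree `T` rooted at `v`. -/
noncomputable def rooting (hT : T.IsTree) (v : N) : RootedForest N where
  depth := T.dist v
  parent w := stepToward hT w v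
  depth_parent _ hw := dist_stepToward hT fun h => hw (h ▸ SimpleGraph.dist_self)

theorem parent_rooting_of_adj (hT : T.IsTree) (v : N) {u u' : N} (h : T.Adj u u') :
    ((rooting hT v).parent u = u' ∧ T.dist v u = T.dist v u' + 1) ∨
      ((rooting hT v).parent u' = u ∧ T.dist v u' = T.dist v u + 1) :=
  (hT.dist_eq_dist_add_one_of_adj v h).imp (fun hd => ⟨stepToward_of_dist hT h hd, hd⟩)
    fun hd => ⟨stepToward_of_dist hT h.symm hd, hd⟩

end Tree

section TreeDecomposition

variable {V N : Type*} {G : SimpleGraph V} {T : SimpleGraph N} {bag : N → Set V} {D n : ℕ}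

/-- A tree decomposition of `G` in the usual sense: bags indexed by the nodes of a tree `T` cover
all vertices and edges, and the nodes whose bags contain a given vertex form a subtree. -/
structure IsTreeDecomposition (G : SimpleGraph V) (T : SimpleGraph N) (bag : N → Set V) :
    Prop where
  isTree : T.IsTree
  connected_nodes : ∀ x, (T.induce {w | x ∈ bag w}).Connected
  adj_mem : ∀ x y, G.Adj x y → ∃ w, x ∈ bag w ∧ y ∈ bag w

namespace IsTreeDecomposition

theorem anc_of_topmost (h : IsTreeDecomposition G T bag) (v : N) {x : V} {w₀ w : N}
    (hmin : ∀ u, x ∈ bag u → T.dist v w₀ ≤ T.dist v u) (hw₀ : x ∈ bag w₀) (hw : x ∈ bag w) :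
    (rooting h.isTree v).Anc w₀ w ∧ ∀ u, (rooting h.isTree v).Anc w₀ u →
      (rooting h.isTree v).Anc u w → x ∈ bag u := by
  have hreach := (h.connected_nodes x).preconnected ⟨w₀, hw₀⟩ ⟨w, hw⟩
  rw [SimpleGraph.reachable_iff_reflTransGen] at hreach
  generalize hp : (⟨w, hw⟩ : {w | x ∈ bag w}) = p at hreach
  obtain rfl : w = p.1 := congrArg Subtype.val hp
  clear hp
  induction hreach with
  | refl => exact ⟨.refl, fun u hu hu' => hu.antisymm hu' ▸ hw₀⟩
  | @tail a b _ hab ih =>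
    obtain ⟨hanc, hmem⟩ := ih a.2
    have hab : T.Adj a.1 b.1 := hab
    rcases parent_rooting_of_adj h.isTree v hab with ⟨hpar, hdist⟩ | ⟨hpar, hdist⟩
    · have hdepth : T.dist v a.1 ≠ 0 := hdist ▸ Nat.succ_ne_zero _
      refine ⟨?_, fun u hu hub => hmem u hu (.of_parent hdepth (hpar.symm ▸ hub))⟩
      cases hanc with
      | refl => exact absurd (hmin b.1 hw) (by omega)
      | of_parent _ hanc => exact hpar ▸ hanc
    · have hdepth : T.dist v b.1 ≠ 0 := hdist ▸ Nat.succ_ne_zero _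
      refine ⟨.of_parent hdepth (hpar.symm ▸ hanc), fun u hu hub => ?_⟩
      cases hub with
      | refl => exact hw
      | of_parent _ hub => exact hmem u hu (hpar ▸ hub)

theorem mem_parent (h : IsTreeDecomposition G T bag) (v : N) {x : V} {w₀ w : N}
    (hmin : ∀ u, x ∈ bag u → T.dist v w₀ ≤ T.dist v u) (hw₀ : x ∈ bag w₀) (hw : x ∈ bag w)
    (hne : w₀ ≠ w) : w ≠ v ∧ x ∈ bag (stepToward h.isTree w v) := by
  obtain ⟨hanc, hmem⟩ := h.anc_of_topmost v hmin hw₀ hw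
  cases hanc with
  | refl => exact absurd rfl hne
  | of_parent hdepth hanc =>
    exact ⟨fun hwv => hdepth (hwv ▸ SimpleGraph.dist_self),
      hmem _ hanc (.of_parent hdepth .refl)⟩

theorem exists_isRootedDecomposition (h : IsTreeDecomposition G T bag)
    (hD : ∀ w w', T.Adj w w' → ∀ s ∈ bag w ∩ bag w', ∀ s' ∈ bag w ∩ bag w', G.dist s s' ≤ D) :
    ∃ (F : RootedForest N) (home : V → N), IsRootedDecomposition G F bag home D := by
  obtain ⟨v⟩ := h.isTree.connected.nonempty
  have htop : ∀ x, ∃ w₀, x ∈ bag w₀ ∧ ∀ u, x ∈ bag u → T.dist v w₀ ≤ T.dist v u := by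
    intro x
    obtain ⟨w⟩ := (h.connected_nodes x).nonempty
    obtain ⟨w₀, hw₀, hmin⟩ := exists_minimalFor_of_wellFoundedLT (x ∈ bag ·) (T.dist v) ⟨w.1, w.2⟩
    exact ⟨w₀, hw₀, fun u hu => (le_total _ _).elim id fun hle => hmin hu hle⟩
  choose home hhome hmin using htop
  have hparent : ∀ w, ∀ x ∈ adhesion bag home w, w ≠ v ∧ x ∈ bag (stepToward h.isTree w v) :=
    fun w x hx => h.mem_parent v (hmin x) (hhome x) hx.1 hx.2
  refine ⟨rooting h.isTree v, home, hhome, fun w x hx hdepth => ?_,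
    fun w x hx => (hparent w x hx).2, h.adj_mem, fun w s hs s' hs' => ?_⟩
  · exact (hparent w x hx).1 (h.isTree.connected.dist_eq_zero_iff.mp hdepth).symm
  · exact hD w _ (adj_stepToward h.isTree (hparent w s hs).1) s ⟨hs.1, (hparent w s hs).2⟩ s'
      ⟨hs'.1, (hparent w s' hs').2⟩

theorem colouringDimLE [NeZero n] (h : IsTreeDecomposition G T bag) (hG : G.Connected)
    (hD : ∀ w w', T.Adj w w' → ∀ s ∈ bag w ∩ bag w', ∀ s' ∈ bag w ∩ bag w', G.dist s s' ≤ D)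
    (hbag : ∀ R, ∃ B : ℕ, ∀ w, ∃ c : V → Fin (n + 1), ∀ x ∈ bag w, ∀ y,
      ReflTransGen (fun a b => a ∈ bag w ∧ b ∈ bag w ∧ MonoStep G c R a b) x y → G.dist x y ≤ B) :
    ColouringDimLE G n := by
  obtain ⟨F, home, hF⟩ := h.exists_isRootedDecomposition hD
  intro R
  obtain ⟨B, hB⟩ := hbag (R + 2 * (R + D))
  choose c hc using hB
  obtain ⟨B', hB'⟩ := hF.exists_boundedChains (κ := Fin (n + 1)) hG R B
  refine ⟨B', hB' (fun x => c (home x) x) fun x y hxy => hc (home x) x (hF.mem_home x) y ?_⟩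
  have hhome : home x = home y ∧ ReflTransGen (fun a b => a ∈ bag (home x) ∧ b ∈ bag (home x) ∧
      MonoStep G (c (home x)) (R + 2 * (R + D)) a b) x y := by
    induction hxy with
    | refl => exact ⟨rfl, .refl⟩
    | @tail y z _ hyz ih =>
      obtain ⟨hcol, hdist⟩ := hyz
      have hxz : home x = home z := ih.1.trans (congrArg Prod.fst hcol)
      have hcol : c (home y) y = c (home z) z := congrArg Prod.snd hcol
      refine ⟨hxz, ih.2.tail ⟨ih.1 ▸ hF.mem_home y, hxz ▸ hF.mem_home z, ?_, hdist⟩⟩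
      rwa [← ih.1, ← hxz] at hcol
  exact hhome.2

end IsTreeDecomposition

end TreeDecomposition

section LocallyInjective

variable {V N : Type*} {H : SimpleGraph V} {T : SimpleGraph N} {f : H →g T}

theorem isPath_map_of_injOn (hT : T.IsAcyclic) (hf : ∀ a, (H.neighborSet a).InjOn f) {a b : V}
    {q : H.Walk a b} (hq : q.IsPath) : (q.map f).IsPath := by
  induction q with
  | nil => exact .nil
  | @cons a c b hac q ih =>
    rw [SimpleGraph.Walk.cons_isPath_iff] at hq
    refine (SimpleGraph.Walk.cons_isPath_iff _ _).mpr ⟨ih hq.1, fun ha => ?_⟩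
    have hsnd := hT.eq_snd_of_adj_start (ih hq.1) (f.map_adj hac).symm ha
    cases q with
    | nil => exact (f.map_adj hac).ne hsnd
    | @cons c d b hcd q =>
      obtain rfl : a = d := hf c hac.symm hcd (by simpa using hsnd)
      exact hq.2 (by simp)

theorem eq_of_reachable_of_injOn (hT : T.IsAcyclic) (hf : ∀ a, (H.neighborSet a).InjOn f) {a b : V}
    (h : H.Reachable a b) (hab : f a = f b) : a = b := by
  obtain ⟨q, hq⟩ := h.exists_isPath
  have hnil := (isPath_map_of_injOn hT hf hq).nil_iff_eq.mpr hab
  exact SimpleGraph.Walk.Nil.eq (by simpa using hnil)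

theorem exists_adj_stepToward_of_injOn (hT : T.IsTree) (hf : ∀ a, (H.neighborSet a).InjOn f)
    {a b : V} (h : H.Reachable a b) (hab : f a ≠ f b) :
    ∃ c, H.Adj a c ∧ H.Reachable c b ∧ f c = stepToward hT (f a) (f b) := by
  obtain ⟨q, hq⟩ := h.exists_isPath
  rw [stepToward_eq_snd hT (isPath_map_of_injOn hT.isAcyclic hf hq)]
  cases q with
  | nil => exact absurd rfl hab
  | cons hac q => exact ⟨_, hac, ⟨q⟩, (SimpleGraph.Walk.snd_cons (q.map f) (f.map_adj hac)).symm⟩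

theorem adj_of_reachable_of_injOn (hT : T.IsTree) (hf : ∀ a, (H.neighborSet a).InjOn f) {a b : V}
    (h : H.Reachable a b) (hab : T.Adj (f a) (f b)) : H.Adj a b := by
  obtain ⟨c, hac, hcb, hc⟩ := exists_adj_stepToward_of_injOn hT hf h hab.ne
  rw [stepToward_of_adj hT hab] at hc
  exact eq_of_reachable_of_injOn hT.isAcyclic hf hcb hc ▸ hac

end LocallyInjective

section Edist

variable {V V' : Type*} {G : SimpleGraph V} {G' : SimpleGraph V'}

theorem edist_le_mul_length {f : V → V'} {K : ℕ} (hf : ∀ x y, G.Adj x y → G'.edist (f x) (f y) ≤ K)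
    {x y : V} (q : G.Walk x y) : G'.edist (f x) (f y) ≤ (K * q.length : ℕ) := by
  induction q with
  | nil => simp
  | @cons x z y hxz q ih =>
    refine (G'.edist_triangle (v := f z)).trans ((add_le_add (hf x z hxz) ih).trans_eq ?_)
    rw [SimpleGraph.Walk.length_cons, ← Nat.cast_add, mul_add, mul_one, add_comm]

theorem edist_embedding (f : G ↪g G') (hf : ∀ x b, G'.Adj (f x) b → b ∈ Set.range f) (x y : V) :
    G'.edist (f x) (f y) = G.edist x y := by
  have hwalk : ∀ {a b : V'} (q : G'.Walk a b) (x : V), f x = a →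
      ∃ y, f y = b ∧ G.edist x y ≤ q.length := by
    intro a b q
    induction q with
    | nil => exact fun x hx => ⟨x, hx, by simp⟩
    | cons hac q ih =>
      rintro x rfl
      obtain ⟨z, rfl⟩ := hf x _ hac
      obtain ⟨y, hy, hzy⟩ := ih z rfl
      refine ⟨y, hy, (G.edist_triangle (v := z)).trans ?_⟩
      rw [SimpleGraph.edist_eq_one_iff_adj.mpr (f.map_adj_iff.mp hac), add_comm,
        SimpleGraph.Walk.length_cons, Nat.cast_add]
      exact add_le_add hzy le_rfl
  refine le_antisymm (edist_map_le f.toHom x y) (le_iInf fun q => ?_)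
  obtain ⟨z, hz, hxz⟩ := hwalk q x rfl
  exact f.injective hz ▸ hxz

end Edist

section TreeOfCopies

variable {N W : Type*} {T : SimpleGraph N} {node : W → N} {C Bd : SimpleGraph W} {D n : ℕ}

/-- The graph obtained from `C` by adding the bonds `Bd` and contracting them. -/
abbrev contraction (C Bd : SimpleGraph W) : SimpleGraph Bd.ConnectedComponent :=
  (C ⊔ Bd).map Bd.connectedComponentMk

theorem exists_adj_of_contraction_adj {x y : Bd.ConnectedComponent}
    (h : (contraction C Bd).Adj x y) :
    ∃ a b, C.Adj a b ∧ Bd.connectedComponentMk a = x ∧ Bd.connectedComponentMk b = y := by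
  obtain ⟨hne, a, b, hab | hab, rfl, rfl⟩ := h
  · exact ⟨a, b, hab, rfl, rfl⟩
  · exact absurd (SimpleGraph.ConnectedComponent.connectedComponentMk_eq_of_adj hab) hne

theorem edist_contraction_le (a b : W) :
    (contraction C Bd).edist (Bd.connectedComponentMk a) (Bd.connectedComponentMk b) ≤
      C.edist a b := by
  refine le_iInf fun q => (edist_le_mul_length (K := 1) (fun a b hab => ?_) q).trans_eq (by simp)
  by_cases h : Bd.connectedComponentMk a = Bd.connectedComponentMk b
  · simp [h]
  · have hadj : (contraction C Bd).Adj (Bd.connectedComponentMk a) (Bd.connectedComponentMk b) :=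
      ⟨h, a, b, .inl hab, rfl, rfl⟩
    exact (SimpleGraph.edist_eq_one_iff_adj.mpr hadj).le

theorem edist_le_of_boundedChains {V κ : Type*} {G : SimpleGraph V} {f : V → W} {c : W → κ}
    {R B : ℕ} (hG : G.Connected) (hf : ∀ x y, C.edist (f x) (f y) = G.edist x y)
    (hnode : ∀ x b, node (f x) = node b → b ∈ Set.range f) (hc : BoundedChains G (c ∘ f) R B)
    {x : V} {b : W} (hb : ReflTransGen
      (fun a b => node a = node b ∧ c a = c b ∧ C.edist a b ≤ R) (f x) b) :
    C.edist (f x) b ≤ B := by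
  have hlift : ∃ y, f y = b ∧ ReflTransGen (MonoStep G (c ∘ f) R) x y := by
    induction hb with
    | refl => exact ⟨x, rfl, .refl⟩
    | tail _ hstep ih =>
      obtain ⟨y, rfl, hxy⟩ := ih
      obtain ⟨hyz, hcol, hdist⟩ := hstep
      obtain ⟨z, rfl⟩ := hnode y _ hyz
      exact ⟨z, rfl, hxy.tail ⟨hcol, ENat.toNat_le_of_le_natCast ((hf y z).symm.trans_le hdist)⟩⟩
  obtain ⟨y, rfl, hxy⟩ := hlift
  rw [hf, ← (hG x y).coe_dist_eq_edist]
  exact_mod_cast hc x y hxy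

/-- A family of graphs indexed by the nodes of a tree `T`, with disjoint union `C`, and bonds `Bd`
that match vertices of neighbouring members of the family. The sets of attachment have diameter at
most `D`. -/
structure IsTreeOfCopies (T : SimpleGraph N) (node : W → N) (C Bd : SimpleGraph W) (D : ℕ) :
    Prop where
  isTree : T.IsTree
  bond_adj : ∀ a b, Bd.Adj a b → T.Adj (node a) (node b)
  bond_unique : ∀ a b b', Bd.Adj a b → Bd.Adj a b' → node b = node b' → b = b'
  copy_node : ∀ a b, C.Adj a b → node a = node b
  edist_le : ∀ a b a' b', Bd.Adj a b → Bd.Adj a' b' → node a = node a' → node b = node b' →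
    C.edist a a' ≤ D

namespace IsTreeOfCopies

theorem eq_of_mk_eq (h : IsTreeOfCopies T node C Bd D) {a b : W}
    (hab : Bd.connectedComponentMk a = Bd.connectedComponentMk b) (hnode : node a = node b) :
    a = b :=
  eq_of_reachable_of_injOn (f := ⟨node, h.bond_adj _ _⟩) h.isTree.isAcyclic
    (fun a _ hb _ hb' => h.bond_unique a _ _ hb hb') (SimpleGraph.ConnectedComponent.exact hab)
    hnode

theorem adj_of_mk_eq (h : IsTreeOfCopies T node C Bd D) {a b : W}
    (hab : Bd.connectedComponentMk a = Bd.connectedComponentMk b)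
    (hnode : T.Adj (node a) (node b)) : Bd.Adj a b :=
  adj_of_reachable_of_injOn (f := ⟨node, h.bond_adj _ _⟩) h.isTree
    (fun a _ hb _ hb' => h.bond_unique a _ _ hb hb') (SimpleGraph.ConnectedComponent.exact hab)
    hnode

theorem exists_adj_of_mk_eq (h : IsTreeOfCopies T node C Bd D) {a b : W}
    (hab : Bd.connectedComponentMk a = Bd.connectedComponentMk b) (hnode : node a ≠ node b) :
    ∃ c, Bd.Adj a c ∧ node c = stepToward h.isTree (node a) (node b) := by
  obtain ⟨c, hac, -, hc⟩ := exists_adj_stepToward_of_injOn (f := ⟨node, h.bond_adj _ _⟩) h.isTree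
    (fun a _ hb _ hb' => h.bond_unique a _ _ hb hb') (SimpleGraph.ConnectedComponent.exact hab)
    hnode
  exact ⟨c, hac, hc⟩

/-- The image of the copy at the node `w` in the contraction. -/
def bag (node : W → N) (Bd : SimpleGraph W) (w : N) : Set Bd.ConnectedComponent :=
  Bd.connectedComponentMk '' (node ⁻¹' {w})

theorem isTreeDecomposition (h : IsTreeOfCopies T node C Bd D) :
    IsTreeDecomposition (contraction C Bd) T (bag node Bd) where
  isTree := h.isTree
  connected_nodes x := by
    induction x using SimpleGraph.ConnectedComponent.ind with | _ a
    refine SimpleGraph.connected_iff_exists_forall_reachable _ |>.mpr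
      ⟨⟨node a, a, rfl, rfl⟩, ?_⟩
    rintro ⟨_, b, rfl, hb⟩
    have hab := SimpleGraph.ConnectedComponent.exact hb.symm
    rw [SimpleGraph.reachable_iff_reflTransGen] at hab
    induction hab with
    | refl => exact .refl _
    | @tail b c _ hbc ih =>
      have hb' := (SimpleGraph.ConnectedComponent.connectedComponentMk_eq_of_adj hbc).trans hb
      exact (ih hb').trans (SimpleGraph.Adj.reachable (h.bond_adj b c hbc))
  adj_mem x y hxy := by
    obtain ⟨a, b, hab, rfl, rfl⟩ := exists_adj_of_contraction_adj hxy
    exact ⟨node a, ⟨a, rfl, rfl⟩, b, (h.copy_node a b hab).symm, rfl⟩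

theorem dist_le_of_mem_bag (h : IsTreeOfCopies T node C Bd D) {w w' : N} (hw : T.Adj w w')
    {s s' : Bd.ConnectedComponent} (hs : s ∈ bag node Bd w ∩ bag node Bd w')
    (hs' : s' ∈ bag node Bd w ∩ bag node Bd w') : (contraction C Bd).dist s s' ≤ D := by
  obtain ⟨⟨a, rfl, rfl⟩, a', rfl, ha⟩ := hs
  obtain ⟨⟨b, hb, rfl⟩, b', hb', hbb'⟩ := hs'
  have haa' := h.adj_of_mk_eq ha.symm hw
  have hbb' : Bd.Adj b b' := h.adj_of_mk_eq hbb'.symm (hb ▸ hb' ▸ hw)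
  exact ENat.toNat_le_of_le_natCast ((edist_contraction_le (Bd := Bd) a b).trans
    (h.edist_le a a' b b' haa' hbb' hb.symm hb'.symm))

/-- The set of vertices of the copy at `v` that are bonded to the copy at `w`. -/
def attachment (node : W → N) (Bd : SimpleGraph W) (v w : N) : Set W :=
  {b | node b = v ∧ ∃ a, node a = w ∧ Bd.Adj b a}

theorem edist_le_of_mem_attachment (h : IsTreeOfCopies T node C Bd D) {v w : N} {b b' : W}
    (hb : b ∈ attachment node Bd v w) (hb' : b' ∈ attachment node Bd v w) : C.edist b b' ≤ D := by
  obtain ⟨rfl, a, rfl, hba⟩ := hb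
  obtain ⟨hnode, a', hnode', hba'⟩ := hb'
  exact h.edist_le b a b' a' hba hba' hnode.symm hnode'.symm

theorem stepToward_eq_of_mk_eq (h : IsTreeOfCopies T node C Bd D) {v : N} {a b : W}
    (hab : Bd.connectedComponentMk a = Bd.connectedComponentMk b)
    (hv : ∀ c, Bd.connectedComponentMk c = Bd.connectedComponentMk a → node c ≠ v) :
    stepToward h.isTree v (node a) = stepToward h.isTree v (node b) := by
  have hreach := SimpleGraph.ConnectedComponent.exact hab
  rw [SimpleGraph.reachable_iff_reflTransGen] at hreach
  induction hreach with
  | refl => rfl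
  | @tail b c _ hbc ih =>
    have hcb := SimpleGraph.ConnectedComponent.connectedComponentMk_eq_of_adj hbc
    exact (ih (hab.trans hcb.symm)).trans
      (stepToward_congr h.isTree (h.bond_adj b c hbc) (hv b (hcb.trans hab.symm)) (hv c hab.symm))

/-- A contracted vertex without a preimage in the copy at `v` may be sent anywhere in that copy,
as long as the choice `g` depends only on the branch of the tree at `v` that contains it. -/
theorem exists_section (h : IsTreeOfCopies T node C Bd D) (v : N) (g : N → W) :
    ∃ r : Bd.ConnectedComponent → W, ∀ a,
      (node a = v → r (Bd.connectedComponentMk a) = a) ∧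
      (node a ≠ v → r (Bd.connectedComponentMk a) ∈
        insert (g (stepToward h.isTree v (node a)))
          (attachment node Bd v (stepToward h.isTree v (node a)))) := by
  have key : ∀ x : Bd.ConnectedComponent, ∃ b, ∀ a, Bd.connectedComponentMk a = x →
      (node a = v → b = a) ∧ (node a ≠ v → b ∈
        insert (g (stepToward h.isTree v (node a)))
          (attachment node Bd v (stepToward h.isTree v (node a)))) := by
    intro x
    by_cases hx : ∃ b, Bd.connectedComponentMk b = x ∧ node b = v
    · obtain ⟨b, rfl, rfl⟩ := hx
      refine ⟨b, fun a ha => ⟨fun hnode => h.eq_of_mk_eq ha.symm hnode.symm, fun hnode => ?_⟩⟩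
      obtain ⟨c, hbc, hc⟩ := h.exists_adj_of_mk_eq ha.symm (Ne.symm hnode)
      exact .inr ⟨rfl, c, hc, hbc⟩
    · push Not at hx
      obtain ⟨b, rfl⟩ := x.exists_rep
      refine ⟨g (stepToward h.isTree v (node b)), fun a ha =>
        ⟨fun hnode => absurd hnode (hx a ha), fun _ => ?_⟩⟩
      exact .inl (congrArg g (h.stepToward_eq_of_mk_eq ha.symm hx))
  choose r hr using key
  exact ⟨r, fun a => hr _ a rfl⟩

theorem exists_retraction (h : IsTreeOfCopies T node C Bd D) [Nonempty W] (v : N) :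
    ∃ r : Bd.ConnectedComponent → W, (∀ a, node a = v → r (Bd.connectedComponentMk a) = a) ∧
      ∀ x y, (contraction C Bd).Adj x y → C.edist (r x) (r y) ≤ (D + 1 : ℕ) := by
  have hg : ∀ w, ∃ b, (attachment node Bd v w).Nonempty → b ∈ attachment node Bd v w := fun w =>
    (attachment node Bd v w).eq_empty_or_nonempty.elim
      (fun he => ⟨Classical.arbitrary W, fun hne => absurd he hne.ne_empty⟩)
      fun ⟨b, hb⟩ => ⟨b, fun _ => hb⟩
  choose g hg using hg
  have hdiam : ∀ w, ∀ b ∈ insert (g w) (attachment node Bd v w),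
      ∀ b' ∈ insert (g w) (attachment node Bd v w), C.edist b b' ≤ D := by
    intro w b hb b' hb'
    rcases (attachment node Bd v w).eq_empty_or_nonempty with he | hne
    · rw [he, insert_empty_eq, Set.mem_singleton_iff] at hb hb'
      simp [hb, hb']
    · rw [Set.insert_eq_of_mem (hg w hne)] at hb hb'
      exact h.edist_le_of_mem_attachment hb hb'
  obtain ⟨r, hr⟩ := h.exists_section v g
  refine ⟨r, fun a => (hr a).1, fun x y hxy => ?_⟩
  obtain ⟨a, b, hab, rfl, rfl⟩ := exists_adj_of_contraction_adj hxy
  have hnode := h.copy_node a b hab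
  by_cases hv : node a = v
  · rw [(hr a).1 hv, (hr b).1 (hnode ▸ hv), SimpleGraph.edist_eq_one_iff_adj.mpr hab]
    exact_mod_cast Nat.le_add_left 1 D
  · refine (hdiam (stepToward h.isTree v (node a)) _ ((hr a).2 hv) _ ?_).trans
      (by exact_mod_cast D.le_succ)
    exact hnode ▸ (hr b).2 (hnode ▸ hv)

theorem colouringDimLE [NeZero n] (h : IsTreeOfCopies T node C Bd D)
    (hG : (contraction C Bd).Connected)
    (hcol : ∀ R : ℕ, ∃ (B : ℕ) (c : W → Fin (n + 1)), ∀ a b,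
      ReflTransGen (fun a b => node a = node b ∧ c a = c b ∧ C.edist a b ≤ R) a b →
        C.edist a b ≤ B) :
    ColouringDimLE (contraction C Bd) n := by
  refine h.isTreeDecomposition.colouringDimLE hG
    (fun w w' hw s hs s' hs' => h.dist_le_of_mem_bag hw hs hs') fun R => ?_
  obtain ⟨B, c, hc⟩ := hcol ((D + 1) * R)
  refine ⟨B, fun w => ?_⟩
  have : Nonempty W := hG.nonempty.elim fun x => x.exists_rep.nonempty
  obtain ⟨r, hr, hadj⟩ := h.exists_retraction w
  have hr' : ∀ x ∈ bag node Bd w, node (r x) = w ∧ Bd.connectedComponentMk (r x) = x := by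
    rintro _ ⟨a, ha, rfl⟩
    rw [hr a ha]
    exact ⟨ha, rfl⟩
  have hlip : ∀ x y, (contraction C Bd).dist x y ≤ R → C.edist (r x) (r y) ≤ ((D + 1) * R : ℕ) := by
    intro x y hxy
    obtain ⟨q, hq⟩ := hG.exists_walk_length_eq_dist x y
    exact (edist_le_mul_length hadj q).trans
      (by exact_mod_cast Nat.mul_le_mul_left (D + 1) (hq.trans_le hxy))
  refine ⟨c ∘ r, fun x hx y hxy => ?_⟩
  have hchain : y ∈ bag node Bd w ∧ ReflTransGen
      (fun a b => node a = node b ∧ c a = c b ∧ C.edist a b ≤ ((D + 1) * R : ℕ)) (r x) (r y) := by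
    induction hxy with
    | refl => exact ⟨hx, .refl⟩
    | tail _ hyz ih =>
      obtain ⟨hy, hz, hcol, hdist⟩ := hyz
      exact ⟨hz, ih.2.tail ⟨(hr' _ hy).1.trans (hr' _ hz).1.symm, hcol, hlip _ _ hdist⟩⟩
  rw [← (hr' x hx).2, ← (hr' y hchain.1).2]
  exact ENat.toNat_le_of_le_natCast ((edist_contraction_le _ _).trans (hc _ _ hchain.2))

end IsTreeOfCopies

end TreeOfCopies

section Adhesion

/-- Every set of the family meets the finitely many sets around orbit representatives, up to
translation. -/
theorem exists_edist_le {V I : Type*} {G : SimpleGraph V} {Γ : Subgroup (G ≃g G)}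
    (hΓ : ActsQuasiTransitively Γ) (hG : G.Connected) {S : I → Set V} (hfin : ∀ k, (S k).Finite)
    (hloc : ∀ x, {k | x ∈ S k}.Finite)
    (hinv : ∀ γ ∈ Γ, ∃ σ : I → I, ∀ k, ∀ x ∈ S k, γ x ∈ S (σ k)) :
    ∃ D : ℕ, ∀ k, ∀ x ∈ S k, ∀ y ∈ S k, G.edist x y ≤ D := by
  obtain ⟨F, hF, horb⟩ := hΓ
  have hpairs : (⋃ k ∈ ⋃ f ∈ F, {k | f ∈ S k}, S k ×ˢ S k).Finite :=
    (hF.biUnion fun f _ => hloc f).biUnion fun k _ => (hfin k).prod (hfin k)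
  obtain ⟨D, hD⟩ := (hpairs.image fun q => G.dist q.1 q.2).bddAbove
  refine ⟨D, fun k x hx y hy => ?_⟩
  obtain ⟨f, hf, γ, hγ, rfl⟩ := horb x
  obtain ⟨σ, hσ⟩ := hinv γ⁻¹ (Γ.inv_mem hγ)
  have hfS : f ∈ S (σ k) := γ.symm_apply_apply f ▸ hσ k _ hx
  have hdist : G.dist f (γ⁻¹ y) ≤ D :=
    hD ⟨(f, γ⁻¹ y), Set.mem_biUnion (Set.mem_biUnion hf hfS) ⟨hfS, hσ k y hy⟩, rfl⟩
  rw [← (hG (γ f) y).coe_dist_eq_edist, ← dist_iso γ⁻¹,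
    show γ⁻¹ (γ f) = f from γ.symm_apply_apply f]
  exact_mod_cast hdist

theorem RespectsGroup.exists_map {V W I J : Type u} {G : SimpleGraph V} {H : SimpleGraph W}
    {S : I → Set V} {R : J → Set W} {φ : ∀ k ℓ, S k ≃ R ℓ} {Γ : Subgroup (G ≃g G)}
    {Δ : Subgroup (H ≃g H)} (h : RespectsGroup φ Γ Δ) :
    ∀ γ ∈ Γ, ∃ σ : I → I, ∀ k, ∀ x ∈ S k, γ x ∈ S (σ k) := by
  intro γ hγ
  obtain ⟨σ, hσ⟩ := h γ hγ
  refine ⟨σ, fun k x hx => ?_⟩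
  obtain ⟨ℓ, τ, -, -, h⟩ := hσ k
  exact (h ⟨x, hx⟩).1

end Adhesion

namespace TreeAmalgam

variable {V₁ V₂ : Type u} {G₁ : SimpleGraph V₁} {G₂ : SimpleGraph V₂} (A : TreeAmalgam G₁ G₂)

section Copies

theorem node_eq_of_copies_adj {a b : A.Vert} (h : A.copies.Adj a b) : A.node a = A.node b := by
  obtain ⟨-, h | h⟩ := h <;> cases h <;> rfl

/-- The copy of `G₁` at the node `u`, as an induced subgraph of the disjoint union of all
copies. -/
def copyLeft (u : A.T₁) : G₁ ↪g A.copies where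
  toFun x := Sum.inl (u, x)
  inj' x y h := congrArg Prod.snd (Sum.inl_injective h)
  map_rel_iff' {x y} := by
    constructor
    · rintro ⟨-, h | h⟩
      · cases h with | left _ _ _ h => exact h
      · cases h with | left _ _ _ h => exact h.symm
    · exact fun h => ⟨fun he => h.ne (congrArg Prod.snd (Sum.inl_injective he)),
        .inl (.left u x y h)⟩

/-- The copy of `G₂` at the node `v`, as an induced subgraph of the disjoint union of all
copies. -/
def copyRight (v : A.T₂) : G₂ ↪g A.copies where
  toFun x := Sum.inr (v, x)
  inj' x y h := congrArg Prod.snd (Sum.inr_injective h)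
  map_rel_iff' {x y} := by
    constructor
    · rintro ⟨-, h | h⟩
      · cases h with | right _ _ _ h => exact h
      · cases h with | right _ _ _ h => exact h.symm
    · exact fun h => ⟨fun he => h.ne (congrArg Prod.snd (Sum.inr_injective he)),
        .inl (.right v x y h)⟩

theorem mem_range_copyLeft {u : A.T₁} {b : A.Vert} (h : Sum.inl u = A.node b) :
    b ∈ Set.range (A.copyLeft u) := by
  rcases b with ⟨u', x⟩ | ⟨v, y⟩
  · obtain rfl : u = u' := Sum.inl_injective h
    exact ⟨x, rfl⟩
  · exact absurd h Sum.inl_ne_inr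

theorem mem_range_copyRight {v : A.T₂} {b : A.Vert} (h : Sum.inr v = A.node b) :
    b ∈ Set.range (A.copyRight v) := by
  rcases b with ⟨u, x⟩ | ⟨v', y⟩
  · exact absurd h Sum.inr_ne_inl
  · obtain rfl : v = v' := Sum.inr_injective h
    exact ⟨y, rfl⟩

theorem edist_copyLeft (u : A.T₁) (x y : V₁) :
    A.copies.edist (A.copyLeft u x) (A.copyLeft u y) = G₁.edist x y :=
  edist_embedding _ (fun _ _ h => A.mem_range_copyLeft (A.node_eq_of_copies_adj h)) x y

theorem edist_copyRight (v : A.T₂) (x y : V₂) :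
    A.copies.edist (A.copyRight v x) (A.copyRight v y) = G₂.edist x y :=
  edist_embedding _ (fun _ _ h => A.mem_range_copyRight (A.node_eq_of_copies_adj h)) x y

theorem exists_colouring_copies {n : ℕ} (hG₁ : G₁.Connected) (hG₂ : G₂.Connected)
    (h₁ : ColouringDimLE G₁ n) (h₂ : ColouringDimLE G₂ n) (R : ℕ) :
    ∃ (B : ℕ) (c : A.Vert → Fin (n + 1)), ∀ a b, ReflTransGen
      (fun a b => A.node a = A.node b ∧ c a = c b ∧ A.copies.edist a b ≤ R) a b →
        A.copies.edist a b ≤ B := by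
  obtain ⟨B₁, c₁, hc₁⟩ := h₁ R
  obtain ⟨B₂, c₂, hc₂⟩ := h₂ R
  let c : A.Vert → Fin (n + 1) := Sum.elim (fun q => c₁ q.2) (fun q => c₂ q.2)
  refine ⟨max B₁ B₂, c, ?_⟩
  rintro (⟨u, x⟩ | ⟨v, y⟩) b hab
  · exact (edist_le_of_boundedChains (c := c) hG₁ (A.edist_copyLeft u)
      (fun _ _ => A.mem_range_copyLeft) hc₁ hab).trans (by exact_mod_cast le_max_left B₁ B₂)
  · exact (edist_le_of_boundedChains (c := c) hG₂ (A.edist_copyRight v)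
      (fun _ _ => A.mem_range_copyRight) hc₂ hab).trans (by exact_mod_cast le_max_right B₁ B₂)

end Copies

section Bonds

theorem bonds_adj_inl_iff {u : A.T₁} {x : V₁} {b : A.Vert} :
    A.bonds.Adj (Sum.inl (u, x)) b ↔
      ∃ (v : A.T₂) (h : A.tree.Adj (Sum.inl u) (Sum.inr v)) (hx : x ∈ A.S₁ (A.label₁ u ⟨v, h⟩)),
        b = Sum.inr (v, (A.φ _ (A.label₂ v ⟨u, h⟩) ⟨x, hx⟩ : V₂)) := by
  constructor
  · rintro ⟨-, h | h⟩ <;> cases h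
    exact ⟨_, _, _, rfl⟩
  · rintro ⟨v, h, hx, rfl⟩
    exact ⟨Sum.inl_ne_inr, .inl (.mk u v h ⟨x, hx⟩)⟩

theorem bonds_adj_inr_iff {v : A.T₂} {y : V₂} {b : A.Vert} :
    A.bonds.Adj (Sum.inr (v, y)) b ↔
      ∃ (u : A.T₁) (h : A.tree.Adj (Sum.inl u) (Sum.inr v)) (hy : y ∈ A.S₂ (A.label₂ v ⟨u, h⟩)),
        b = Sum.inl (u, ((A.φ (A.label₁ u ⟨v, h⟩) _).symm ⟨y, hy⟩ : V₁)) := by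
  constructor
  · rintro ⟨-, h | h⟩ <;> cases h
    exact ⟨_, _, Subtype.coe_prop _, by simp⟩
  · rintro ⟨u, h, hy, rfl⟩
    refine (A.bonds_adj_inl_iff.mpr ⟨v, h, Subtype.coe_prop _, ?_⟩).symm
    simp

theorem finite_labels₁ (hA : A.FiniteIdentification) (u : A.T₁) (x : V₁) :
    {k | x ∈ A.S₁ k}.Finite := by
  obtain ⟨N, hN⟩ := hA
  refine Set.Finite.of_injOn (f := fun k => Sum.inr ((A.label₁ u).symm k).1) (fun k hk => ?_)
    (fun _ _ _ _ h => (A.label₁ u).symm.injective (Subtype.ext (Sum.inr_injective h)))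
    (Set.finite_of_encard_le_coe (hN (A.π (Sum.inl (u, x)))))
  obtain ⟨⟨v, h⟩, rfl⟩ := (A.label₁ u).surjective k
  have hbond := A.bonds_adj_inl_iff.mpr ⟨v, h, hk, rfl⟩
  exact ⟨_, (SimpleGraph.ConnectedComponent.connectedComponentMk_eq_of_adj hbond).symm,
    by simp [node]⟩

theorem finite_labels₂ (hA : A.FiniteIdentification) (v : A.T₂) (y : V₂) :
    {ℓ | y ∈ A.S₂ ℓ}.Finite := by
  obtain ⟨N, hN⟩ := hA
  refine Set.Finite.of_injOn (f := fun ℓ => Sum.inl ((A.label₂ v).symm ℓ).1) (fun ℓ hℓ => ?_)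
    (fun _ _ _ _ h => (A.label₂ v).symm.injective (Subtype.ext (Sum.inl_injective h)))
    (Set.finite_of_encard_le_coe (hN (A.π (Sum.inr (v, y)))))
  obtain ⟨⟨u, h⟩, rfl⟩ := (A.label₂ v).surjective ℓ
  have hbond := A.bonds_adj_inr_iff.mpr ⟨u, h, hℓ, rfl⟩
  exact ⟨_, (SimpleGraph.ConnectedComponent.connectedComponentMk_eq_of_adj hbond).symm,
    by simp [node]⟩

end Bonds

/-- All adhesion sets that belong to an edge of the connecting tree have diameter at most `D`.
Labels in use only: a tree with a single node puts no condition on the sets of the other side. -/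
def BoundedAdhesion (D : ℕ) : Prop :=
  ∀ (u : A.T₁) (v : A.T₂) (h : A.tree.Adj (Sum.inl u) (Sum.inr v)),
    (∀ x ∈ A.S₁ (A.label₁ u ⟨v, h⟩), ∀ x' ∈ A.S₁ (A.label₁ u ⟨v, h⟩), G₁.edist x x' ≤ D) ∧
      ∀ y ∈ A.S₂ (A.label₂ v ⟨u, h⟩), ∀ y' ∈ A.S₂ (A.label₂ v ⟨u, h⟩), G₂.edist y y' ≤ D

variable {A}

theorem BoundedAdhesion.isTreeOfCopies {D : ℕ} (hD : A.BoundedAdhesion D) :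
    IsTreeOfCopies A.tree A.node A.copies A.bonds D where
  isTree := A.isTree
  bond_adj := by
    rintro (⟨u, x⟩ | ⟨v, y⟩) b hb
    · obtain ⟨v, h, -, rfl⟩ := A.bonds_adj_inl_iff.mp hb
      exact h
    · obtain ⟨u, h, -, rfl⟩ := A.bonds_adj_inr_iff.mp hb
      exact h.symm
  bond_unique := by
    rintro (⟨u, x⟩ | ⟨v, y⟩) b b' hb hb' hnode
    · obtain ⟨v, h, hx, rfl⟩ := A.bonds_adj_inl_iff.mp hb
      obtain ⟨v', h', hx', rfl⟩ := A.bonds_adj_inl_iff.mp hb'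
      obtain rfl : v = v' := Sum.inr_injective hnode
      rfl
    · obtain ⟨u, h, hy, rfl⟩ := A.bonds_adj_inr_iff.mp hb
      obtain ⟨u', h', hy', rfl⟩ := A.bonds_adj_inr_iff.mp hb'
      obtain rfl : u = u' := Sum.inl_injective hnode
      rfl
  copy_node _ _ := A.node_eq_of_copies_adj
  edist_le := by
    rintro (⟨u, x⟩ | ⟨v, y⟩) b a' b' hb hb' ha hnode
    · obtain ⟨x', rfl⟩ := A.mem_range_copyLeft ha
      obtain ⟨v, h, hx, rfl⟩ := A.bonds_adj_inl_iff.mp hb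
      obtain ⟨v', h', hx', rfl⟩ := A.bonds_adj_inl_iff.mp hb'
      obtain rfl : v = v' := Sum.inr_injective hnode
      exact (A.edist_copyLeft u x x').trans_le ((hD u v h).1 x hx x' hx')
    · obtain ⟨y', rfl⟩ := A.mem_range_copyRight ha
      obtain ⟨u, h, hy, rfl⟩ := A.bonds_adj_inr_iff.mp hb
      obtain ⟨u', h', hy', rfl⟩ := A.bonds_adj_inr_iff.mp hb'
      obtain rfl : u = u' := Sum.inl_injective hnode
      exact (A.edist_copyRight v y y').trans_le ((hD u v h).2 y hy y' hy')

theorem BoundedAdhesion.colouringDimLE {n D : ℕ} [NeZero n] (hD : A.BoundedAdhesion D)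
    (hA : A.graph.Connected) (hG₁ : G₁.Connected) (hG₂ : G₂.Connected)
    (h₁ : ColouringDimLE G₁ n) (h₂ : ColouringDimLE G₂ n) : ColouringDimLE A.graph n :=
  hD.isTreeOfCopies.colouringDimLE hA (A.exists_colouring_copies hG₁ hG₂ h₁ h₂)

section Actions

variable {Γ₁ : Subgroup (G₁ ≃g G₁)} {Γ₂ : Subgroup (G₂ ≃g G₂)}

theorem RespectsActions.respectsGroups (h : A.RespectsActions Γ₁ Γ₂) : A.RespectsGroups Γ₁ Γ₂ :=
  h.elim (·.1) fun ⟨_, _, _, _, _, h, _⟩ => h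

theorem exists_boundedAdhesion (hG₁ : G₁.Connected) (hG₂ : G₂.Connected) (hfin : A.FiniteAdhesion)
    (hid : A.FiniteIdentification) (hΓ₁ : ActsQuasiTransitively Γ₁)
    (hΓ₂ : ActsQuasiTransitively Γ₂) (hresp : A.RespectsGroups Γ₁ Γ₂) :
    ∃ D, A.BoundedAdhesion D := by
  by_cases hedge : Nonempty A.T₁ ∧ Nonempty A.T₂
  · obtain ⟨⟨u⟩, ⟨v⟩⟩ := hedge
    obtain ⟨D₁, hD₁⟩ := exists_edist_le hΓ₁ hG₁ hfin.1 (A.finite_labels₁ hid u) hresp.1.exists_map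
    obtain ⟨D₂, hD₂⟩ := exists_edist_le hΓ₂ hG₂ hfin.2 (A.finite_labels₂ hid v) hresp.2.exists_map
    refine ⟨max D₁ D₂, fun u v h => ⟨fun x hx x' hx' => ?_, fun y hy y' hy' => ?_⟩⟩
    · exact (hD₁ _ x hx x' hx').trans (by exact_mod_cast le_max_left D₁ D₂)
    · exact (hD₂ _ y hy y' hy').trans (by exact_mod_cast le_max_right D₁ D₂)
  · exact ⟨0, fun u v => absurd ⟨⟨u⟩, ⟨v⟩⟩ hedge⟩

end Actions

end TreeAmalgam

/-- A connected graph, bundled with its vertex type. -/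
structure ConnectedGraph where
  V : Type u
  graph : SimpleGraph V
  connected : graph.Connected

/-- The asymptotic dimension of the vertex set with the path metric. -/
noncomputable def ConnectedGraph.asdim (G : ConnectedGraph.{u}) : ℕ∞ :=
  @TreeAmalg.asdim G.V (graphMetric G.graph G.connected)

theorem ConnectedGraph.asdim_le_coe_iff (G : ConnectedGraph.{u}) {n : ℕ} :
    G.asdim ≤ n ↔ ColouringDimLE G.graph n := by
  let _ := graphMetric G.graph G.connected
  exact TreeAmalg.asdim_le_coe_iff.trans (asdimLE_graphMetric_iff G.connected)

/-- The connected graphs obtained from members of `𝒢` by iterated tree amalgamations whose adhesion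
sets have uniformly bounded diameter, up to isomorphism. -/
inductive IsIteratedAmalgam (𝒢 : Set ConnectedGraph.{u}) : ConnectedGraph.{u} → Prop
  | of_mem (H G : ConnectedGraph.{u}) (hH : H ∈ 𝒢) (e : Nonempty (G.graph ≃g H.graph)) :
      IsIteratedAmalgam 𝒢 G
  | amalgam (G₁ G₂ G : ConnectedGraph.{u}) (h₁ : IsIteratedAmalgam 𝒢 G₁)
      (h₂ : IsIteratedAmalgam 𝒢 G₂) (A : TreeAmalgam G₁.graph G₂.graph) (D : ℕ)
      (hD : A.BoundedAdhesion D) (e : Nonempty (G.graph ≃g A.graph)) : IsIteratedAmalgam 𝒢 G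

theorem IsIteratedAmalgam.colouringDimLE {𝒢 : Set ConnectedGraph.{u}} {G : ConnectedGraph.{u}}
    {n : ℕ} [NeZero n] (h : IsIteratedAmalgam 𝒢 G) (h𝒢 : ∀ H ∈ 𝒢, ColouringDimLE H.graph n) :
    ColouringDimLE G.graph n := by
  induction h with
  | of_mem H G hH e => exact e.elim fun e => (h𝒢 H hH).of_iso e
  | amalgam G₁ G₂ G _ _ A D hD e ih₁ ih₂ =>
    obtain ⟨e⟩ := e
    have hA : A.graph.Connected := e.connected_iff.mp G.connected
    exact (hD.colouringDimLE hA G₁.connected G₂.connected ih₁ ih₂).of_iso e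

/-- The underlying connected graph of a quasi-transitive graph. -/
def QTGraph.toConnectedGraph (G : QTGraph.{u}) : ConnectedGraph.{u} := ⟨G.V, G.graph, G.connected⟩

theorem IsFactorisation.isIteratedAmalgam {L : List QTGraph.{u}} {G : QTGraph.{u}}
    {𝒢 : Set ConnectedGraph.{u}} (h : IsFactorisation L G)
    (hL : ∀ H ∈ L, H.toConnectedGraph ∈ 𝒢) : IsIteratedAmalgam 𝒢 G.toConnectedGraph := by
  induction h with
  | single H G e => exact .of_mem _ _ (hL H (List.mem_singleton_self H)) e
  | amalgam L₁ L₂ G₁ G₂ G _ _ h ih₁ ih₂ =>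
    obtain ⟨A, -, hfin, hid, ⟨Γ₁, Γ₂, hΓ₁, hΓ₂, hresp⟩, e⟩ := h
    obtain ⟨D, hD⟩ := A.exists_boundedAdhesion G₁.connected G₂.connected hfin hid hΓ₁ hΓ₂
      hresp.respectsGroups
    exact .amalgam _ _ _ (ih₁ fun H hH => hL H (List.mem_append_left _ hH))
      (ih₂ fun H hH => hL H (List.mem_append_right _ hH)) A D hD e
  | perm L L' _ hLL' _ ih => exact ih fun H hH => hL H (hLL'.mem_iff.mp hH)

end TreeAmalg

theorem theorem2_general {𝒢 : Set TreeAmalg.ConnectedGraph.{u}} {G : TreeAmalg.ConnectedGraph.{u}}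
    (h : TreeAmalg.IsIteratedAmalgam 𝒢 G) : G.asdim ≤ max 1 (⨆ H ∈ 𝒢, H.asdim) := by
  generalize hm : max 1 (⨆ H ∈ 𝒢, H.asdim) = m
  induction m with
  | top => exact le_top
  | coe m =>
    have : NeZero m := ⟨Nat.one_le_iff_ne_zero.mp (by exact_mod_cast hm ▸ le_max_left _ _)⟩
    refine G.asdim_le_coe_iff.mpr (h.colouringDimLE fun H hH => H.asdim_le_coe_iff.mp ?_)
    exact hm ▸ (le_iSup₂ (f := fun H _ => H.asdim) H hH).trans (le_max_right _ _)

theorem theorem2 (n : ℕ) (F : Fin n → TreeAmalg.QTGraph.{u}) (G : TreeAmalg.QTGraph.{u})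
    (h : TreeAmalg.IsFactorisation (List.ofFn F) G) :
    G.asdim ≤ max 1 (⨆ i, (F i).asdim) :=
  (theorem2_general (h.isIteratedAmalgam (𝒢 := Set.range fun i => (F i).toConnectedGraph)
    fun _ hH => (List.mem_ofFn.mp hH).imp fun _ => congrArg _)).trans_eq (by rw [iSup_range]; rfl)
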